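/- Let $\mathcal R(s)$ denote Riemann's auxiliary function, the entire function $$\mathcal R(s)=\int_{0\swarrow1}\frac{x^{-s}e^{\pi i x^2}}{e^{\pi i x}-e^{-\pi i x}}\,dx,$$ where $x^{-s}=e^{-s\log x}$ with the principal branch of $\log$, and $0\swarrow1$ is the straight line of slope $1$ that crosses the real axis at a point between $0$ and $1$ (say at $\tfrac12$), described from the upper right to the lower left. Then for every real $\sigma<\tfrac12$ the integral below converges for every $\varepsilon>0$, and $$\int_1^\infty |\mathcal R(\sigma+it)|^2\Bigl(\frac{t}{2\pi}\Bigr)^{\sigma} e^{-\varepsilon t}\,dt=\frac{(2\varepsilon)^{-3/2}}{1-2\sigma}+o(\varepsilon^{-3/2})\qquad(\varepsilon\to0^+).$$ -/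

import Mathlib

open MeasureTheory Set Filter Topology Asymptotics

/-- The integrand `x ^ (-s) e ^ (π i x²) / (e ^ (π i x) - e ^ (-π i x))` in the definition of the
auxiliary function, with `x ^ (-s) = exp (-s log x)` for the principal branch of `log`. -/
noncomputable def auxIntegrand (s x : ℂ) : ℂ :=
  x ^ (-s) * Complex.exp (Real.pi * Complex.I * x ^ 2) /
    (Complex.exp (Real.pi * Complex.I * x) - Complex.exp (-(Real.pi * Complex.I * x)))

/-- Riemann's auxiliary function `ℛ(s) = ∫_{0↙1} x ^ (-s) e ^ (π i x²) / (e ^ (π i x) - e ^ (-π i x)) dx`.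
The path `0↙1` is the straight line of slope `1` that crosses the real axis between `0` and `1`
(here at `1 / 2`), described from the upper right to the lower left. It is parametrized as
`x = 1 / 2 + (1 + i) u` with `u` running from `+∞` to `-∞`, which accounts for the minus sign.
The line meets neither the cut `(-∞, 0]` of the logarithm nor the zeros of the denominator, and
the integrand decays like a Gaussian along it, so that the integral converges absolutely. -/
noncomputable def auxR (s : ℂ) : ℂ :=
  -∫ u : ℝ, auxIntegrand s (1 / 2 + (1 + Complex.I) * (u : ℂ)) * (1 + Complex.I)

/-! Write `a = √(t / 2π)`. On the line of slope 1 through `c`, the numerator has modulus `|x| ^ (-σ)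
exp (2π (a² arg x - (c + u) u))`. The exponent is stationary at `u = 0` when `c = a` and stays below
a Gaussian when `c` is near `a`. Crossing the pole at `n` costs the residue term `n ^ (-s)`. Moving
the line from `1 / 2` to `⌊a⌋ + 1 / 2` therefore gives `auxR s = ∑_{n ≤ a} n ^ (-s) + O(a ^ (-σ))`
(`auxR_eq_sum_add_auxLine`, `exists_norm_auxR_sub_mainSum_le`). After squaring, the weight `a ^
(2σ)` makes the remainder bounded.

In the weighted square of the sum, the diagonal is `a ^ (2σ) ∑_{n ≤ a} n ^ (-2σ) ∼ a / (1 - 2σ)`,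
because `-2σ > -1` (`tendsto_diagSum`). The off-diagonal terms are small only on average. Each pair
oscillates with frequency `log (m / n)`, and integration up to `T` followed by summation over pairs
gives `O(α ^ (2 + τ) log α)` with `α = √(T / 2π)` and `τ = max (2σ) 0 < 1`, hence `o(T ^ (3 / 2))`
(`meanNegligible_offDiagSum`).

An error whose primitive is `o(T ^ (3 / 2))` has Laplace transform `o(ε ^ (-3 / 2))`
(`MeanNegligible.abs_laplace_le`). The main term is explicit: the integral of `√(t / 2π) e ^ (-ε t)`
over `(0, ∞)` is `Γ(3 / 2) ε ^ (-3 / 2) / √(2π) = (2ε) ^ (-3 / 2)`. -/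

/-! ### Bounds for the integrand on lines of slope 1 -/

lemma line_re (c u : ℝ) : ((c : ℂ) + (1 + Complex.I) * u).re = c + u := by simp

lemma line_im (c u : ℝ) : ((c : ℂ) + (1 + Complex.I) * u).im = u := by simp

lemma line_mem_slitPlane {c : ℝ} (hc : 0 < c) (u : ℝ) :
    (c : ℂ) + (1 + Complex.I) * u ∈ Complex.slitPlane := by
  rw [Complex.mem_slitPlane_iff, line_re, line_im]
  rcases eq_or_ne u 0 with rfl | h
  · left; simpa using hc
  · right; exact h

lemma hasDerivAt_arg_line {c : ℝ} (hc : 0 < c) (u : ℝ) :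
    HasDerivAt (fun u : ℝ => Complex.arg ((c : ℂ) + (1 + Complex.I) * u))
      (c / ((c + u) ^ 2 + u ^ 2)) u := by
  have h1 : HasDerivAt (fun u : ℝ => (c : ℂ) + (1 + Complex.I) * u) (1 + Complex.I) u := by
    simpa using ((Complex.ofRealCLM.hasDerivAt (x := u)).const_mul (1 + Complex.I)).const_add (c : ℂ)
  have h2 := h1.clog_real (line_mem_slitPlane hc u)
  have h3 := Complex.imCLM.hasFDerivAt.comp_hasDerivAt u h2
  have h4 : HasDerivAt (fun u : ℝ => Complex.arg ((c : ℂ) + (1 + Complex.I) * u))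
      (Complex.imCLM ((1 + Complex.I) / ((c : ℂ) + (1 + Complex.I) * u))) u := by
    refine h3.congr_of_eventuallyEq (Eventually.of_forall fun v => ?_)
    simp [Complex.log_im]
  convert h4 using 1
  rw [Complex.imCLM_apply, Complex.div_im, line_re, line_im, Complex.normSq_apply, line_re, line_im]
  simp
  have : (c + u) ^ 2 + u ^ 2 ≠ 0 := by
    have : 0 < (c + u) ^ 2 + u ^ 2 := by nlinarith [sq_nonneg (c + 2 * u), sq_pos_of_pos hc]
    exact this.ne'
  have h5 : (c + u) * (c + u) + u * u ≠ 0 := by convert this using 1; ring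
  field_simp
  ring

/-- The exponent of the integrand on the line `c + (1 + i) u` is dominated by a Gaussian one. -/
lemma arg_line_le {c t B : ℝ} (hc : 0 < c) (ht : 0 ≤ t)
    (hB : |t / (2 * Real.pi) / c - c| ≤ B) (u : ℝ) :
    t * Complex.arg ((c : ℂ) + (1 + Complex.I) * u) - 2 * Real.pi * ((c + u) * u) ≤
      2 * Real.pi * (B * |u| - u ^ 2 / 2) := by
  obtain ⟨A, rfl⟩ : ∃ A, t = 2 * Real.pi * A := ⟨t / (2 * Real.pi), by field_simp⟩
  have hA : 0 ≤ A := by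
    by_contra! h
    nlinarith [mul_pos Real.pi_pos (neg_pos.2 h)]
  have hB' : |A / c - c| ≤ B := by
    convert hB using 3
    field_simp
  have hq : ∀ u : ℝ, 0 < (c + u) ^ 2 + u ^ 2 := fun u => by
    nlinarith [sq_nonneg (c + 2 * u), sq_pos_of_pos hc]
  suffices h : A * Complex.arg ((c : ℂ) + (1 + Complex.I) * u) - (c + u) * u ≤
      B * |u| - u ^ 2 / 2 by nlinarith [Real.pi_pos]
  rw [abs_le] at hB'
  have hAc : A / c * c = A := by field_simp
  -- On each side `φ`, the difference of the two sides, vanishes at `0`. It decreases for `u ≥ 0`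
  -- and increases for `u ≤ 0`.
  rcases le_total 0 u with hu | hu
  · let φ : ℝ → ℝ := fun u => A * Complex.arg ((c : ℂ) + (1 + Complex.I) * u) - (c + u) * u -
      (B * u - u ^ 2 / 2)
    have hd : ∀ v, HasDerivAt φ (A * (c / ((c + v) ^ 2 + v ^ 2)) - (1 * v + (c + v) * 1) -
        (B * 1 - (2 : ℕ) * v ^ (2 - 1) * 1 / 2)) v := fun v =>
      (((hasDerivAt_arg_line hc v).const_mul A).sub
        (((hasDerivAt_id v).const_add c).mul (hasDerivAt_id v))).sub
        (((hasDerivAt_id v).const_mul B).sub (((hasDerivAt_id v).pow 2).div_const 2))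
    have hanti : AntitoneOn φ (Ici 0) := by
      refine antitoneOn_of_hasDerivWithinAt_nonpos (convex_Ici 0)
        (fun v _ => (hd v).continuousAt.continuousWithinAt)
        (fun v _ => (hd v).hasDerivWithinAt) fun v hv => ?_
      rw [interior_Ici] at hv
      have hv : 0 < v := hv
      have : A * (c / ((c + v) ^ 2 + v ^ 2)) ≤ A / c := by
        rw [div_eq_mul_inv A c]
        gcongr
        rw [div_le_iff₀ (hq v), inv_mul_eq_div, le_div_iff₀ hc]
        nlinarith
      norm_num
      linarith
    have := hanti (mem_Ici.2 le_rfl) (mem_Ici.2 hu) hu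
    simp only [φ] at this
    rw [abs_of_nonneg hu]
    have h0 : Complex.arg ((c : ℂ) + (1 + Complex.I) * (0 : ℝ)) = 0 := by
      simpa using Complex.arg_ofReal_of_nonneg hc.le
    rw [h0] at this
    linarith
  · let φ : ℝ → ℝ := fun u => A * Complex.arg ((c : ℂ) + (1 + Complex.I) * u) - (c + u) * u -
      (-(B * u) - u ^ 2 / 2)
    have hd : ∀ v, HasDerivAt φ (A * (c / ((c + v) ^ 2 + v ^ 2)) - (1 * v + (c + v) * 1) -
        (-(B * 1) - (2 : ℕ) * v ^ (2 - 1) * 1 / 2)) v := fun v =>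
      (((hasDerivAt_arg_line hc v).const_mul A).sub
        (((hasDerivAt_id v).const_add c).mul (hasDerivAt_id v))).sub
        (((hasDerivAt_id v).const_mul B).neg.sub (((hasDerivAt_id v).pow 2).div_const 2))
    have hmono : MonotoneOn φ (Iic 0) := by
      refine monotoneOn_of_hasDerivWithinAt_nonneg (convex_Iic 0)
        (fun v _ => (hd v).continuousAt.continuousWithinAt)
        (fun v _ => (hd v).hasDerivWithinAt) fun v hv => ?_
      rw [interior_Iic] at hv
      have hv : v < 0 := hv
      norm_num
      -- For `-c ≤ v < 0` the denominator `c² + 2v(c + v)` is at most `c²`, so the slope of the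
      -- argument term is at least `A / c`. For `v ≤ -c` its nonnegativity suffices, since `-v - c +
      -- B ≥ 0`.
      rcases le_total (-v) c with h | h
      · have : A / c ≤ A * (c / ((c + v) ^ 2 + v ^ 2)) := by
          rw [div_eq_mul_inv A c]
          gcongr
          rw [le_div_iff₀ (hq v), inv_mul_eq_div, div_le_iff₀ hc]
          nlinarith
        linarith
      · have : 0 ≤ A * (c / ((c + v) ^ 2 + v ^ 2)) := by
          have := hq v
          positivity
        linarith
    have := hmono (mem_Iic.2 hu) (mem_Iic.2 le_rfl) hu
    simp only [φ] at this
    rw [abs_of_nonpos hu]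
    have h0 : Complex.arg ((c : ℂ) + (1 + Complex.I) * (0 : ℝ)) = 0 := by
      simpa using Complex.arg_ofReal_of_nonneg hc.le
    rw [h0] at this
    linarith

/-- The line stays at distance at least `c / 2` from the origin, which serves `σ ≥ 0`. For `σ ≤ 0`,
`c ≥ 1 / 2` gives `|x| ≤ c + 2|u| ≤ c (1 + 4|u|) ≤ c e ^ (4|u|)`. -/
lemma norm_line_rpow_le {c : ℝ} (hc : 1 / 2 ≤ c) (σ u : ℝ) :
    ‖(c : ℂ) + (1 + Complex.I) * u‖ ^ (-σ) ≤
      2 ^ |σ| * c ^ (-σ) * Real.exp (4 * |σ| * |u|) := by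
  have hc0 : 0 < c := by linarith
  have hsq : ‖(c : ℂ) + (1 + Complex.I) * u‖ ^ 2 = (c + u) ^ 2 + u ^ 2 := by
    rw [← Complex.normSq_eq_norm_sq, Complex.normSq_apply, line_re, line_im]; ring
  have hlow : c / 2 ≤ ‖(c : ℂ) + (1 + Complex.I) * u‖ := by
    refine le_of_sq_le_sq ?_ (norm_nonneg _)
    rw [hsq]
    nlinarith [sq_nonneg (c + 2 * u)]
  have hup : ‖(c : ℂ) + (1 + Complex.I) * u‖ ≤ c * Real.exp (4 * |u|) := by
    have h1 : ‖(c : ℂ) + (1 + Complex.I) * u‖ ≤ c + 2 * |u| := by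
      refine le_of_sq_le_sq ?_ (by positivity)
      rw [hsq]
      nlinarith [sq_abs u, abs_nonneg u, le_abs_self u]
    have h2 := Real.add_one_le_exp (4 * |u|)
    nlinarith [abs_nonneg u]
  rcases le_total 0 σ with h | h
  · rw [abs_of_nonneg h]
    calc ‖(c : ℂ) + (1 + Complex.I) * u‖ ^ (-σ) ≤ (c / 2) ^ (-σ) :=
          Real.rpow_le_rpow_of_nonpos (by positivity) hlow (by linarith)
      _ = 2 ^ σ * c ^ (-σ) := by
          rw [Real.div_rpow hc0.le (by norm_num), Real.rpow_neg (by norm_num : (0 : ℝ) ≤ 2)]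
          field_simp
      _ ≤ 2 ^ σ * c ^ (-σ) * Real.exp (4 * σ * |u|) :=
          le_mul_of_one_le_right (by positivity) (Real.one_le_exp (by positivity))
  · rw [abs_of_nonpos h]
    have h0 : 0 ≤ -σ := by linarith
    calc ‖(c : ℂ) + (1 + Complex.I) * u‖ ^ (-σ) ≤ (c * Real.exp (4 * |u|)) ^ (-σ) :=
          Real.rpow_le_rpow (norm_nonneg _) hup h0
      _ = 1 * c ^ (-σ) * Real.exp (4 * -σ * |u|) := by
          rw [Real.mul_rpow hc0.le (Real.exp_pos _).le, ← Real.exp_mul]; ring_nf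
      _ ≤ 2 ^ (-σ) * c ^ (-σ) * Real.exp (4 * -σ * |u|) := by
          gcongr
          exact Real.one_le_rpow (by norm_num) h0

/-- The denominator is `2i sin (πx)`. -/
lemma norm_den_sq (x : ℂ) :
    ‖Complex.exp (Real.pi * Complex.I * x) - Complex.exp (-(Real.pi * Complex.I * x))‖ ^ 2 =
      4 * (Real.sin (Real.pi * x.re) ^ 2 + Real.sinh (Real.pi * x.im) ^ 2) := by
  have h : Complex.exp (Real.pi * Complex.I * x) - Complex.exp (-(Real.pi * Complex.I * x)) =
      2 * Complex.I * Complex.sin (Real.pi * x) := by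
    rw [Complex.sin]
    ring_nf
    simp only [Complex.I_sq]
    ring
  have h2 : Complex.sin (Real.pi * x) =
      ((Real.sin (Real.pi * x.re) * Real.cosh (Real.pi * x.im) : ℝ) : ℂ) +
        ((Real.cos (Real.pi * x.re) * Real.sinh (Real.pi * x.im) : ℝ) : ℂ) * Complex.I := by
    rw [Complex.sin_eq]
    simp
  rw [h, norm_mul, mul_pow, h2, ← Complex.normSq_eq_norm_sq (_ + _), Complex.normSq_add_mul_I]
  simp
  nlinarith [Real.cosh_sq (Real.pi * x.im), Real.sin_sq_add_cos_sq (Real.pi * x.re)]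

lemma abs_le_abs_sinh (y : ℝ) : |y| ≤ |Real.sinh y| := by
  rcases le_total 0 y with h | h
  · rw [abs_of_nonneg h, abs_of_nonneg (Real.sinh_nonneg_iff.2 h)]
    exact Real.self_le_sinh_iff.2 h
  · rw [abs_of_nonpos h, abs_of_nonpos (Real.sinh_nonpos_iff.2 h)]
    exact neg_le_neg (Real.sinh_le_self_iff.2 h)

lemma two_mul_abs_im_le_norm_den (x : ℂ) : 2 * |x.im| ≤
    ‖Complex.exp (Real.pi * Complex.I * x) - Complex.exp (-(Real.pi * Complex.I * x))‖ := by
  refine le_of_sq_le_sq ?_ (norm_nonneg _)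
  rw [norm_den_sq]
  have h := sq_le_sq.2 (abs_le_abs_sinh (Real.pi * x.im))
  nlinarith [sq_nonneg (Real.sin (Real.pi * x.re)), sq_abs x.im, Real.pi_gt_three,
    mul_nonneg (sq_nonneg x.im) (by nlinarith [Real.pi_gt_three] : 0 ≤ Real.pi ^ 2 - 1)]

/-- At half-integers the sine becomes `± cos (πu)`, and `|sinh (πu)| ≥ |πu| ≥ |sin (πu)|` supplies
the missing part of `cos² + sin² = 1`. -/
lemma two_le_norm_den (N : ℕ) (u : ℝ) : 2 ≤
    ‖Complex.exp (Real.pi * Complex.I * (((N + 1 / 2 : ℝ) : ℂ) + (1 + Complex.I) * u)) -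
      Complex.exp (-(Real.pi * Complex.I * (((N + 1 / 2 : ℝ) : ℂ) + (1 + Complex.I) * u)))‖ := by
  refine le_of_sq_le_sq ?_ (norm_nonneg _)
  rw [norm_den_sq, line_re, line_im]
  have h1 : Real.sin (Real.pi * (N + 1 / 2 + u)) ^ 2 = Real.cos (Real.pi * u) ^ 2 := by
    have : Real.pi * (N + 1 / 2 + u) = (Real.pi * u + Real.pi / 2) + N * Real.pi := by ring
    rw [this, Real.sin_add_nat_mul_pi, mul_pow, Real.sin_add_pi_div_two, ← pow_mul, mul_comm N 2,
      pow_mul]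
    simp
  have h2 := sq_le_sq.2 (abs_le_abs_sinh (Real.pi * u))
  have h3 := sq_le_sq.2 (Real.abs_sin_le_abs (x := Real.pi * u))
  rw [h1]
  nlinarith [Real.sin_sq_add_cos_sq (Real.pi * u)]

/-- The constant in the Gaussian bound for the integrand. -/
noncomputable def lineConst (σ B : ℝ) : ℝ :=
  2 ^ |σ| * Real.exp ((4 * |σ| + 2 * Real.pi * B) ^ 2 / (2 * Real.pi))

lemma lineConst_pos (σ B : ℝ) : 0 < lineConst σ B := by
  unfold lineConst; positivity

lemma norm_num_line_le {c t B σ : ℝ} (hc : 1 / 2 ≤ c) (ht : 0 ≤ t)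
    (hB : |t / (2 * Real.pi) / c - c| ≤ B) (u : ℝ) :
    ‖((c : ℂ) + (1 + Complex.I) * u) ^ (-((σ : ℂ) + t * Complex.I)) *
      Complex.exp (Real.pi * Complex.I * ((c : ℂ) + (1 + Complex.I) * u) ^ 2)‖ ≤
    lineConst σ B * c ^ (-σ) * Real.exp (-(Real.pi / 2) * u ^ 2) := by
  have hc0 : 0 < c := by linarith
  have hne := Complex.slitPlane_ne_zero (line_mem_slitPlane hc0 u)
  have h1 := arg_line_le hc0 ht hB u
  rw [norm_mul, Complex.norm_cpow_of_ne_zero hne, Complex.norm_exp]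
  have hre : (Real.pi * Complex.I * ((c : ℂ) + (1 + Complex.I) * u) ^ 2).re =
      -(2 * Real.pi * ((c + u) * u)) := by
    simp [pow_two]
    ring
  have hs1 : (-((σ : ℂ) + t * Complex.I)).re = -σ := by simp
  have hs2 : (-((σ : ℂ) + t * Complex.I)).im = -t := by simp
  rw [hre, hs1, hs2, div_mul_eq_mul_div, mul_div_assoc, ← Real.exp_sub]
  have h2 : -(2 * Real.pi * ((c + u) * u)) - Complex.arg ((c : ℂ) + (1 + Complex.I) * u) * -t ≤
      2 * Real.pi * (B * |u| - u ^ 2 / 2) := by linarith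
  calc _ ≤ (2 ^ |σ| * c ^ (-σ) * Real.exp (4 * |σ| * |u|)) *
        Real.exp (2 * Real.pi * (B * |u| - u ^ 2 / 2)) := by
        gcongr
        exact norm_line_rpow_le hc σ u
    _ = 2 ^ |σ| * c ^ (-σ) * Real.exp ((4 * |σ| + 2 * Real.pi * B) * |u| - Real.pi * u ^ 2) := by
        rw [mul_assoc, ← Real.exp_add]; ring_nf
    _ ≤ 2 ^ |σ| * c ^ (-σ) * Real.exp ((4 * |σ| + 2 * Real.pi * B) ^ 2 / (2 * Real.pi) +
          -(Real.pi / 2) * u ^ 2) := by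
        gcongr
        -- Completing the square: half of the Gaussian absorbs the linear term `A|u|`, at the cost
        -- of the constant `A² / 2π`.
        set A := 4 * |σ| + 2 * Real.pi * B
        have : A ^ 2 / (2 * Real.pi) + -(Real.pi / 2) * u ^ 2 - (A * |u| - Real.pi * u ^ 2) =
            (A - Real.pi * |u|) ^ 2 / (2 * Real.pi) := by
          field_simp
          rw [← sq_abs u]
          ring
        have h3 : 0 ≤ (A - Real.pi * |u|) ^ 2 / (2 * Real.pi) := by positivity
        linarith
    _ = _ := by
        rw [Real.exp_add, lineConst]; ring

/-! ### Residues in a horizontal strip -/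

/-- The integrand is `2ib / (x² + b²)`, with primitive `2i arctan (x / b)`. This is the contribution
of the bare pole `1 / w`. -/
lemma tendsto_integral_inv_sub_inv {b : ℝ} (hb : 0 < b) :
    Tendsto (fun R : ℝ => ∫ x in (-R)..R,
      (((x : ℂ) + ((-b : ℝ) : ℂ) * Complex.I)⁻¹ - ((x : ℂ) + (b : ℂ) * Complex.I)⁻¹)) atTop
      (𝓝 (2 * Real.pi * Complex.I)) := by
  have h1 : ∀ x : ℝ, (((x : ℂ) + ((-b : ℝ) : ℂ) * Complex.I)⁻¹ -
      ((x : ℂ) + (b : ℂ) * Complex.I)⁻¹) =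
      ((2 * (1 / (1 + (x / b) ^ 2) * (1 / b)) : ℝ) : ℂ) * Complex.I := by
    intro x
    have e1 : (x : ℂ) + ((-b : ℝ) : ℂ) * Complex.I ≠ 0 := fun h => by
      have := congrArg Complex.im h
      simp at this
      exact hb.ne' this
    have e2 : (x : ℂ) + (b : ℂ) * Complex.I ≠ 0 := fun h => by
      have := congrArg Complex.im h
      simp at this
      exact hb.ne' this
    have e3 : (b : ℂ) ≠ 0 := by exact_mod_cast hb.ne'
    have e4 : (b : ℂ) ^ 2 + (x : ℂ) ^ 2 ≠ 0 := by
      have : (0 : ℝ) < b ^ 2 + x ^ 2 := by positivity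
      exact_mod_cast this.ne'
    have e5 : (1 : ℂ) + ((x : ℂ) / b) ^ 2 ≠ 0 := by
      intro h
      apply e4
      field_simp at h
      simpa using h
    have e6 : ((x : ℂ) + ((-b : ℝ) : ℂ) * Complex.I) * ((x : ℂ) + (b : ℂ) * Complex.I) =
        (b : ℂ) ^ 2 + (x : ℂ) ^ 2 := by
      push_cast
      linear_combination (-(b : ℂ) ^ 2) * Complex.I_sq
    rw [inv_sub_inv e1 e2, e6]
    push_cast
    field_simp
    ring
  have h2 : ∀ R : ℝ, ∫ x in (-R)..R, (((x : ℂ) + ((-b : ℝ) : ℂ) * Complex.I)⁻¹ -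
      ((x : ℂ) + (b : ℂ) * Complex.I)⁻¹) =
      ((2 * Real.arctan (R / b) - 2 * Real.arctan (-R / b) : ℝ) : ℂ) * Complex.I := by
    intro R
    simp_rw [h1]
    rw [intervalIntegral.integral_mul_const, intervalIntegral.integral_ofReal]
    congr 2
    have hd : ∀ x : ℝ, HasDerivAt (fun x : ℝ => 2 * Real.arctan (x / b))
        (2 * (1 / (1 + (x / b) ^ 2) * (1 / b))) x := fun x =>
      (((hasDerivAt_id x).div_const b).arctan).const_mul 2
    refine intervalIntegral.integral_eq_sub_of_hasDerivAt (fun x _ => hd x) ?_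
    apply Continuous.intervalIntegrable
    have : ∀ x : ℝ, 1 + (x / b) ^ 2 ≠ 0 := fun x => by positivity
    fun_prop (disch := assumption)
  simp_rw [h2]
  have h3 : Tendsto (fun R : ℝ => 2 * Real.arctan (R / b) - 2 * Real.arctan (-R / b)) atTop
      (𝓝 (2 * Real.pi)) := by
    have h4 : Tendsto (fun R : ℝ => Real.arctan (R / b)) atTop (𝓝 (Real.pi / 2)) :=
      (tendsto_nhds_of_tendsto_nhdsWithin Real.tendsto_arctan_atTop).comp
        (tendsto_id.atTop_div_const hb)
    convert h4.const_mul 4 using 1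
    · ext R
      rw [neg_div, Real.arctan_neg]; ring
    · ring_nf
  have h5 := ((Complex.continuous_ofReal.tendsto _).comp h3).mul_const Complex.I
  simpa using h5

/-- The residue theorem for a simple pole in a horizontal strip. -/
theorem integral_strip_sub {q : ℂ → ℂ} {b C : ℝ} {U : Set ℂ} (hb : 0 < b)
    (hU : IsOpen U) (hsub : ∀ w : ℂ, |w.im| ≤ b → w ∈ U) (hq : DifferentiableOn ℂ q U)
    (hC : ∀ w : ℂ, |w.im| ≤ b → 1 ≤ |w.re| → ‖q w‖ ≤ C)
    (hlow : Integrable fun u : ℝ => q ((u : ℂ) + ((-b : ℝ) : ℂ) * Complex.I) *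
      ((u : ℂ) + ((-b : ℝ) : ℂ) * Complex.I)⁻¹)
    (hup : Integrable fun u : ℝ => q ((u : ℂ) + (b : ℂ) * Complex.I) *
      ((u : ℂ) + (b : ℂ) * Complex.I)⁻¹) :
    (∫ u : ℝ, q ((u : ℂ) + ((-b : ℝ) : ℂ) * Complex.I) *
      ((u : ℂ) + ((-b : ℝ) : ℂ) * Complex.I)⁻¹) -
    (∫ u : ℝ, q ((u : ℂ) + (b : ℂ) * Complex.I) * ((u : ℂ) + (b : ℂ) * Complex.I)⁻¹) =
      2 * Real.pi * Complex.I * q 0 := by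
  have h0U : (0 : ℂ) ∈ U := hsub 0 (by simpa using hb.le)
  -- `dslope q 0` is `(q w - q 0) / w` with the singularity removed. Cauchy's theorem on rectangles
  -- applies to it, and the residue comes from the remaining `q 0 / w`.
  have hk : DifferentiableOn ℂ (dslope q 0) U :=
    (Complex.differentiableOn_dslope (hU.mem_nhds h0U)).2 hq
  have hkeq : ∀ w : ℂ, w ≠ 0 → dslope q 0 w = (q w - q 0) * w⁻¹ := by
    intro w hw
    rw [dslope_of_ne _ hw, slope_def_field, sub_zero, div_eq_mul_inv]
  have hline : ∀ β : ℝ, |β| = b → ∀ u : ℝ, (u : ℂ) + (β : ℂ) * Complex.I ≠ 0 := by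
    intro β hβ u h
    have := congrArg Complex.im h
    simp at this
    rw [this, abs_zero] at hβ
    exact hb.ne hβ
  have hcont : ∀ β : ℝ, |β| = b → Continuous fun u : ℝ => dslope q 0 ((u : ℂ) + (β : ℂ) * Complex.I) := by
    intro β hβ
    refine hk.continuousOn.comp_continuous (by fun_prop) fun u => hsub _ ?_
    simp [hβ]
  have hcinv : ∀ β : ℝ, |β| = b → Continuous fun u : ℝ => ((u : ℂ) + (β : ℂ) * Complex.I)⁻¹ :=
    fun β hβ => Continuous.inv₀ (by fun_prop) (hline β hβ)
  have hbb : |-b| = b := by rw [abs_neg, abs_of_pos hb]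
  have hbb' : |b| = b := abs_of_pos hb
  have hvert : ∀ R : ℝ, 1 ≤ |R| → ‖∫ y in (-b)..b, dslope q 0 ((R : ℂ) + (y : ℂ) * Complex.I)‖ ≤
      (C + ‖q 0‖) / |R| * |b - -b| := by
    intro R hR
    refine intervalIntegral.norm_integral_le_of_norm_le_const fun y hy => ?_
    rw [uIoc_of_le (by linarith)] at hy
    have hy' : |y| ≤ b := abs_le.2 ⟨hy.1.le, hy.2⟩
    have hRn : |R| ≤ ‖(R : ℂ) + (y : ℂ) * Complex.I‖ := by
      simpa using Complex.abs_re_le_norm ((R : ℂ) + (y : ℂ) * Complex.I)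
    have hRpos : 0 < |R| := by linarith
    have hne : (R : ℂ) + (y : ℂ) * Complex.I ≠ 0 := norm_pos_iff.1 (by linarith)
    have hqb := hC ((R : ℂ) + (y : ℂ) * Complex.I) (by simpa using hy') (by simpa using hR)
    rw [hkeq _ hne, norm_mul, norm_inv, div_eq_mul_inv]
    have h1 : ‖q ((R : ℂ) + (y : ℂ) * Complex.I) - q 0‖ ≤ C + ‖q 0‖ :=
      (norm_sub_le _ _).trans (add_le_add_left hqb _)
    have := (norm_nonneg _).trans h1
    gcongr
  -- The vertical sides vanish in the limit like `1 / R`. The function `e` covers `R` and `-R`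
  -- together.
  have hV : ∀ e : ℝ → ℝ, (∀ R, |e R| = |R|) →
      Tendsto (fun R : ℝ => ∫ y in (-b)..b, dslope q 0 (((e R : ℝ) : ℂ) + (y : ℂ) * Complex.I))
      atTop (𝓝 0) := by
    intro e he
    refine squeeze_zero_norm' (a := fun R : ℝ => (C + ‖q 0‖) / R * |b - -b|) ?_ ?_
    · filter_upwards [eventually_ge_atTop 1] with R hR
      have h1 : |R| = R := abs_of_nonneg (by linarith)
      have := hvert (e R) (by rw [he, h1]; exact hR)
      rwa [he, h1] at this
    · simpa using (tendsto_const_nhds (x := C + ‖q 0‖)).div_atTop tendsto_id |>.mul_const (|b - -b|)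
  have hrect : ∀ R : ℝ,
      (∫ x in (-R)..R, dslope q 0 ((x : ℂ) + ((-b : ℝ) : ℂ) * Complex.I)) -
      (∫ x in (-R)..R, dslope q 0 ((x : ℂ) + (b : ℂ) * Complex.I)) +
      Complex.I • (∫ y in (-b)..b, dslope q 0 ((R : ℂ) + (y : ℂ) * Complex.I)) -
      Complex.I • (∫ y in (-b)..b, dslope q 0 (((-R : ℝ) : ℂ) + (y : ℂ) * Complex.I)) = 0 := by
    intro R
    have := Complex.integral_boundary_rect_eq_zero_of_differentiableOn (dslope q 0)
      ⟨-R, -b⟩ ⟨R, b⟩ (hk.mono ?_)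
    · simpa only using this
    · intro w hw
      apply hsub
      have h2 := hw.2
      simp only [mem_preimage] at h2
      rw [uIcc_of_le (by linarith)] at h2
      exact abs_le.2 h2
  have hsplit : ∀ R : ℝ,
      (∫ x in (-R)..R, q ((x : ℂ) + ((-b : ℝ) : ℂ) * Complex.I) *
        ((x : ℂ) + ((-b : ℝ) : ℂ) * Complex.I)⁻¹) -
      (∫ x in (-R)..R, q ((x : ℂ) + (b : ℂ) * Complex.I) *
        ((x : ℂ) + (b : ℂ) * Complex.I)⁻¹) =
      ((∫ x in (-R)..R, dslope q 0 ((x : ℂ) + ((-b : ℝ) : ℂ) * Complex.I)) -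
      (∫ x in (-R)..R, dslope q 0 ((x : ℂ) + (b : ℂ) * Complex.I))) +
      q 0 * ∫ x in (-R)..R, (((x : ℂ) + ((-b : ℝ) : ℂ) * Complex.I)⁻¹ -
        ((x : ℂ) + (b : ℂ) * Complex.I)⁻¹) := by
    intro R
    have key : ∀ β : ℝ, |β| = b → (∫ x in (-R)..R, q ((x : ℂ) + (β : ℂ) * Complex.I) *
        ((x : ℂ) + (β : ℂ) * Complex.I)⁻¹) =
        (∫ x in (-R)..R, dslope q 0 ((x : ℂ) + (β : ℂ) * Complex.I)) +
        q 0 * ∫ x in (-R)..R, ((x : ℂ) + (β : ℂ) * Complex.I)⁻¹ := by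
      intro β hβ
      rw [← intervalIntegral.integral_const_mul, ← intervalIntegral.integral_add
        ((hcont β hβ).intervalIntegrable _ _)
        (((hcinv β hβ).const_mul _).intervalIntegrable _ _)]
      refine intervalIntegral.integral_congr fun x _ => ?_
      rw [hkeq _ (hline β hβ x)]
      ring
    rw [key (-b) hbb, key b hbb', intervalIntegral.integral_sub
      ((hcinv (-b) hbb).intervalIntegrable _ _) ((hcinv b hbb').intervalIntegrable _ _)]
    ring
  have hL := (intervalIntegral_tendsto_integral hlow tendsto_neg_atTop_atBot tendsto_id).sub
    (intervalIntegral_tendsto_integral hup tendsto_neg_atTop_atBot tendsto_id)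
  refine tendsto_nhds_unique hL ?_
  have hR := (((hV (fun R => -R) fun R => abs_neg R).const_smul Complex.I).sub
    ((hV id fun R => rfl).const_smul Complex.I)).add
    ((tendsto_integral_inv_sub_inv hb).const_mul (q 0))
  have : Complex.I • (0 : ℂ) - Complex.I • 0 + q 0 * (2 * Real.pi * Complex.I) =
      2 * Real.pi * Complex.I * q 0 := by simp; ring
  rw [this] at hR
  refine hR.congr fun R => ?_
  rw [id, hsplit]
  linear_combination -(hrect R)

/-! ### Moving the line of integration across the integers -/

/-- The integral of `auxIntegrand` along the line of slope `1` through `c`. -/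
noncomputable def auxLine (s : ℂ) (c : ℝ) : ℂ :=
  -∫ u : ℝ, auxIntegrand s ((c : ℂ) + (1 + Complex.I) * (u : ℂ)) * (1 + Complex.I)

lemma auxR_eq_auxLine (s : ℂ) : auxR s = auxLine s (((0 : ℕ) : ℝ) + 1 / 2) := by
  simp [auxR, auxLine]

lemma norm_auxIntegrand_halfLine_le {N : ℕ} {t B σ : ℝ} (ht : 0 ≤ t)
    (hB : |t / (2 * Real.pi) / (N + 1 / 2 : ℝ) - (N + 1 / 2 : ℝ)| ≤ B) (u : ℝ) :
    ‖auxIntegrand ((σ : ℂ) + t * Complex.I) (((N + 1 / 2 : ℝ) : ℂ) + (1 + Complex.I) * u)‖ ≤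
    lineConst σ B * (N + 1 / 2 : ℝ) ^ (-σ) * Real.exp (-(Real.pi / 2) * u ^ 2) / 2 := by
  rw [auxIntegrand, norm_div]
  have hN : (1 / 2 : ℝ) ≤ N + 1 / 2 := by
    have : (0 : ℝ) ≤ N := N.cast_nonneg
    linarith
  have := norm_num_line_le (σ := σ) hN ht hB u
  have hp := lineConst_pos σ B
  have h2 := two_le_norm_den N u
  gcongr

lemma continuous_auxIntegrand_halfLine (N : ℕ) (s : ℂ) :
    Continuous fun u : ℝ =>
      auxIntegrand s (((N + 1 / 2 : ℝ) : ℂ) + (1 + Complex.I) * u) := by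
  have hN : (0 : ℝ) < N + 1 / 2 := by positivity
  unfold auxIntegrand
  refine Continuous.div ?_ (by fun_prop) ?_
  · refine Continuous.mul ?_ (by fun_prop)
    exact Continuous.cpow (by fun_prop) continuous_const fun u => line_mem_slitPlane hN u
  · intro u h
    have := two_le_norm_den N u
    rw [h, norm_zero] at this
    norm_num at this

lemma integrable_gauss : Integrable fun u : ℝ => Real.exp (-(Real.pi / 2) * u ^ 2) :=
  integrable_exp_neg_mul_sq (by positivity)

lemma integrable_auxIntegrand_halfLine (N : ℕ) {t : ℝ} (σ : ℝ) (ht : 0 ≤ t) :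
    Integrable fun u : ℝ => auxIntegrand ((σ : ℂ) + t * Complex.I)
      (((N + 1 / 2 : ℝ) : ℂ) + (1 + Complex.I) * u) := by
  refine Integrable.mono' ((integrable_gauss.const_mul _).div_const 2)
    (continuous_auxIntegrand_halfLine N _).aestronglyMeasurable
    (Eventually.of_forall fun u => norm_auxIntegrand_halfLine_le ht le_rfl u)

lemma norm_auxLine_le {N : ℕ} {t B σ : ℝ} (ht : 0 ≤ t)
    (hB : |t / (2 * Real.pi) / (N + 1 / 2 : ℝ) - (N + 1 / 2 : ℝ)| ≤ B) :
    ‖auxLine ((σ : ℂ) + t * Complex.I) (N + 1 / 2 : ℝ)‖ ≤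
      2 * lineConst σ B * (N + 1 / 2 : ℝ) ^ (-σ) := by
  rw [auxLine, norm_neg]
  have hg : ∫ u : ℝ, Real.exp (-(Real.pi / 2) * u ^ 2) ≤ 2 := by
    rw [integral_gaussian]
    have : Real.pi / (Real.pi / 2) = 2 := by field_simp
    rw [this]
    exact Real.sqrt_le_iff.2 ⟨by norm_num, by norm_num⟩
  have h2 : ‖1 + Complex.I‖ ≤ 2 := by
    refine (norm_add_le _ _).trans ?_
    simp; norm_num
  have hp := lineConst_pos σ B
  calc _ ≤ ∫ u : ℝ, lineConst σ B * (N + 1 / 2 : ℝ) ^ (-σ) *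
        Real.exp (-(Real.pi / 2) * u ^ 2) := by
        refine norm_integral_le_of_norm_le (integrable_gauss.const_mul _)
          (Eventually.of_forall fun u => ?_)
        rw [norm_mul]
        have := norm_auxIntegrand_halfLine_le (σ := σ) ht hB u
        have := mul_le_mul this h2 (norm_nonneg _) (by positivity)
        linarith
    _ = lineConst σ B * (N + 1 / 2 : ℝ) ^ (-σ) * ∫ u : ℝ, Real.exp (-(Real.pi / 2) * u ^ 2) :=
        integral_const_mul _ _
    _ ≤ lineConst σ B * (N + 1 / 2 : ℝ) ^ (-σ) * 2 := by gcongr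
    _ = _ := by ring

lemma den_eq_zero {x : ℂ} (h : Complex.exp (Real.pi * Complex.I * x) -
    Complex.exp (-(Real.pi * Complex.I * x)) = 0) : ∃ k : ℤ, x = k := by
  have h1 := norm_den_sq x
  rw [h, norm_zero] at h1
  have hs : Real.sin (Real.pi * x.re) = 0 := by
    nlinarith [sq_nonneg (Real.sin (Real.pi * x.re)), sq_nonneg (Real.sinh (Real.pi * x.im))]
  have hsh : Real.sinh (Real.pi * x.im) = 0 := by
    nlinarith [sq_nonneg (Real.sin (Real.pi * x.re)), sq_nonneg (Real.sinh (Real.pi * x.im))]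
  rw [Real.sin_eq_zero_iff] at hs
  rw [Real.sinh_eq_zero] at hsh
  obtain ⟨k, hk⟩ := hs
  refine ⟨k, Complex.ext ?_ ?_⟩
  · simp
    have := Real.pi_pos
    nlinarith
  · simpa [Real.pi_ne_zero] using hsh

/-- Moving the line of integration across the pole `n` picks up the term `n ^ (-s)`. -/
theorem auxLine_sub_auxLine {n : ℕ} (hn : 1 ≤ n) (σ : ℝ) {t : ℝ} (ht : 0 ≤ t) :
    auxLine ((σ : ℂ) + t * Complex.I) (n - 1 / 2 : ℝ) -
      auxLine ((σ : ℂ) + t * Complex.I) (n + 1 / 2 : ℝ) =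
      (n : ℂ) ^ (-((σ : ℂ) + t * Complex.I)) := by
  set s : ℂ := (σ : ℂ) + t * Complex.I with hs
  have hn1 : (1 : ℝ) ≤ n := by exact_mod_cast hn
  let den : ℂ → ℂ := fun x => Complex.exp (Real.pi * Complex.I * x) -
    Complex.exp (-(Real.pi * Complex.I * x))
  let num : ℂ → ℂ := fun x => x ^ (-s) * Complex.exp (Real.pi * Complex.I * x ^ 2)
  -- The rotated coordinate turns the horizontal line of height `β` into the line of slope 1 through
  -- `n - 2β`. Heights `∓1 / 4` give `n ± 1 / 2`.
  let X : ℂ → ℂ := fun w => (n : ℂ) + (1 + Complex.I) * w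
  let D : ℂ → ℂ := dslope den n
  let q : ℂ → ℂ := fun w => num (X w) / D (X w)
  -- This strip lies strictly between the lines through `n - 1` and `n + 1`. It contains no integer
  -- other than `n` and avoids the cut of the logarithm because `n ≥ 1`.
  let U : Set ℂ := {w | |w.im| < 1 / 2}
  have h1I : (1 + Complex.I : ℂ) ≠ 0 := fun h => by
    have := congrArg Complex.re h
    simp at this
  have hUo : IsOpen U := isOpen_lt (by fun_prop) continuous_const
  have hX : ∀ w : ℂ, X w = ((n - 2 * w.im : ℝ) : ℂ) + (1 + Complex.I) * ((w.re + w.im : ℝ) : ℂ) := by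
    intro w
    apply Complex.ext
    · simp [X]; ring
    · simp [X]; ring
  have hdend : Differentiable ℂ den := by
    intro x; simp only [den]; fun_prop
  have hdenderiv : HasDerivAt den (2 * Real.pi * Complex.I * (-1) ^ n) n := by
    have h1 : HasDerivAt (fun x : ℂ => Real.pi * Complex.I * x) (Real.pi * Complex.I * 1) (n : ℂ) :=
      (hasDerivAt_id _).const_mul _
    refine (h1.cexp.sub h1.neg.cexp).congr_deriv ?_
    rw [Pi.neg_apply]
    have e1 : Complex.exp (Real.pi * Complex.I * n) = (-1) ^ n := by
      rw [mul_comm, Complex.exp_nat_mul, Complex.exp_pi_mul_I]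
    rw [Complex.exp_neg, e1]
    rcases Nat.even_or_odd n with h | h
    · rw [h.neg_one_pow]; norm_num; ring
    · rw [h.neg_one_pow]; norm_num; ring
  have hdenn : den n = 0 := by
    simp only [den]
    have e1 : Complex.exp (Real.pi * Complex.I * n) = (-1) ^ n := by
      rw [mul_comm, Complex.exp_nat_mul, Complex.exp_pi_mul_I]
    rw [Complex.exp_neg, e1]
    rcases Nat.even_or_odd n with h | h
    · rw [h.neg_one_pow]; norm_num
    · rw [h.neg_one_pow]; norm_num
  have hDd : Differentiable ℂ D := by
    rw [← differentiableOn_univ]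
    exact (Complex.differentiableOn_dslope univ_mem).2 hdend.differentiableOn
  have hDn : D n = 2 * Real.pi * Complex.I * (-1) ^ n := by
    simp only [D]
    rw [dslope_same, hdenderiv.deriv]
  have hDne : ∀ x : ℂ, x ≠ n → D x = den x / (x - n) := by
    intro x hx
    simp only [D]
    rw [dslope_of_ne _ hx, slope_def_field, hdenn, sub_zero]
  have hpi : (Real.pi : ℂ) ≠ 0 := by exact_mod_cast Real.pi_ne_zero
  have hXn : ∀ w, w ≠ 0 → X w ≠ n := by
    intro w hw h
    simp only [X] at h
    rw [add_eq_left, mul_eq_zero] at h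
    exact h.elim h1I hw
  have hDX : ∀ w ∈ U, D (X w) ≠ 0 := by
    intro w hw h
    rcases eq_or_ne w 0 with rfl | hw0
    · have : X 0 = n := by simp [X]
      rw [this, hDn] at h
      simp [hpi] at h
    · have hxn := hXn w hw0
      rw [hDne _ hxn, div_eq_zero_iff] at h
      rcases h with h | h
      · obtain ⟨k, hk⟩ := den_eq_zero h
        have hw' : |w.im| < 1 / 2 := hw
        rw [abs_lt] at hw'
        have h2 := congrArg Complex.re ((hX w).symm.trans hk)
        rw [line_re] at h2
        have h3 := congrArg Complex.im ((hX w).symm.trans hk)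
        rw [line_im] at h3
        simp at h2 h3
        have h4 : (k : ℝ) < ((n + 1 : ℤ) : ℝ) := by push_cast; linarith
        have h5 : ((n - 1 : ℤ) : ℝ) < (k : ℝ) := by push_cast; linarith
        have h6 : k < n + 1 := by exact_mod_cast h4
        have h7 : (n : ℤ) - 1 < k := by exact_mod_cast h5
        have h8 : k = n := by omega
        apply hxn
        rw [hk, h8]
        simp
      · exact hxn (sub_eq_zero.1 h)
  have hqd : DifferentiableOn ℂ q U := by
    intro w hw
    apply DifferentiableAt.differentiableWithinAt
    have hXd : DifferentiableAt ℂ X w := by simp only [X]; fun_prop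
    refine DifferentiableAt.div ?_ ((hDd _).comp w hXd) (hDX w hw)
    have hsl : X w ∈ Complex.slitPlane := by
      rw [hX]
      have hw' : |w.im| < 1 / 2 := hw
      rw [abs_lt] at hw'
      exact line_mem_slitPlane (by linarith) _
    refine DifferentiableAt.mul ?_ (by fun_prop)
    exact DifferentiableAt.cpow_const hXd hsl
  have hqf : ∀ w, w ≠ 0 → q w * w⁻¹ = auxIntegrand s (X w) * (1 + Complex.I) := by
    intro w hw
    have : q w = num (X w) / (den (X w) / ((1 + Complex.I) * w)) := by
      simp only [q]
      rw [hDne _ (hXn w hw)]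
      simp [X]
    rw [this, auxIntegrand]
    simp only [num, den]
    field_simp
  have hq0 : q 0 = (n : ℂ) ^ (-s) / (2 * Real.pi * Complex.I) := by
    have h1 : X 0 = n := by simp [X]
    -- Since `n²` and `n` have the same parity, this sign cancels the `(-1) ^ n` in the derivative
    -- of the denominator.
    have h2 : Complex.exp (Real.pi * Complex.I * (n : ℂ) ^ 2) = (-1) ^ n := by
      have : Real.pi * Complex.I * (n : ℂ) ^ 2 = ((n * n : ℕ) : ℂ) * (Real.pi * Complex.I) := by
        push_cast; ring
      rw [this, Complex.exp_nat_mul, Complex.exp_pi_mul_I]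
      rcases Nat.even_or_odd n with h | h
      · rw [h.neg_one_pow, (h.mul_right n).neg_one_pow]
      · rw [h.neg_one_pow, (h.mul h).neg_one_pow]
    simp only [q, num]
    rw [h1, hDn, h2]
    have : ((-1 : ℂ)) ^ n ≠ 0 := pow_ne_zero _ (by norm_num)
    field_simp
  -- Here `q w = w (1 + i)` times the integrand. The denominator is at least `2|Re w + Im w| ≥ 2|Re
  -- w| - 1 / 2`, so `|w| / |den| ≤ 2`. With `|1 + i| ≤ 2` this gives the factor `4`. The crossing
  -- point `c` lies in `[1 / 2, n + 1]`, hence a uniform `B`.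
  have hcell : ∀ w : ℂ, |w.im| ≤ 1 / 4 → 1 ≤ |w.re| →
      ‖q w‖ ≤ 4 * (lineConst σ (2 * (t / (2 * Real.pi)) + (n + 1)) * (2 ^ |σ| * (n + 1) ^ |σ|)) := by
    intro w hw hwre
    have hw0 : w ≠ 0 := by
      rintro rfl
      simp at hwre
      norm_num at hwre
    have e1 : q w = w * (auxIntegrand s (X w) * (1 + Complex.I)) := by
      rw [← hqf w hw0]; field_simp
    have him := two_mul_abs_im_le_norm_den (X w)
    rw [hX, line_im, ← hX] at him
    have hw' := abs_le.1 hw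
    set c : ℝ := n - 2 * w.im with hc
    have hc1 : 1 / 2 ≤ c := by linarith [hw'.2]
    have hc2 : c ≤ n + 1 := by linarith [hw'.1]
    have hA : 0 ≤ t / (2 * Real.pi) := by positivity
    have hB : |t / (2 * Real.pi) / c - c| ≤ 2 * (t / (2 * Real.pi)) + (n + 1) := by
      have h1 : t / (2 * Real.pi) / c ≤ 2 * (t / (2 * Real.pi)) := by
        rw [div_le_iff₀ (by linarith)]
        nlinarith
      have h2 : 0 ≤ t / (2 * Real.pi) / c := div_nonneg hA (by linarith)
      rw [abs_le]
      constructor <;> linarith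
    have hnum := norm_num_line_le (σ := σ) hc1 ht hB (w.re + w.im)
    rw [← hX] at hnum
    have hcs : c ^ (-σ) ≤ 2 ^ |σ| * (n + 1) ^ |σ| := by
      rcases le_total 0 σ with h | h
      · rw [abs_of_nonneg h]
        calc c ^ (-σ) ≤ (1 / 2 : ℝ) ^ (-σ) :=
              Real.rpow_le_rpow_of_nonpos (by norm_num) hc1 (by linarith)
          _ = 2 ^ σ * 1 := by rw [one_div, Real.inv_rpow (by norm_num), Real.rpow_neg (by norm_num)]; simp
          _ ≤ _ := by
              gcongr
              exact Real.one_le_rpow (by linarith) h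
      · rw [abs_of_nonpos h]
        calc c ^ (-σ) ≤ 1 * (n + 1 : ℝ) ^ (-σ) := by
              rw [one_mul]
              exact Real.rpow_le_rpow (by linarith) hc2 (by linarith)
          _ ≤ _ := by
              gcongr
              exact Real.one_le_rpow (by norm_num) (by linarith)
    have hv : |w.re| - 1 / 4 ≤ |w.re + w.im| := by
      have := abs_sub_abs_le_abs_sub w.re (-w.im)
      rw [abs_neg, sub_neg_eq_add] at this
      linarith
    have hdpos : 0 < ‖den (X w)‖ := by
      refine lt_of_lt_of_le ?_ him
      linarith
    have hwn : ‖w‖ ≤ |w.re| + |w.im| := Complex.norm_le_abs_re_add_abs_im w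
    have h2 : ‖1 + Complex.I‖ ≤ 2 := by
      refine (norm_add_le _ _).trans ?_
      simp; norm_num
    have hexp : Real.exp (-(Real.pi / 2) * (w.re + w.im) ^ 2) ≤ 1 := by
      rw [Real.exp_le_one_iff]
      have := Real.pi_pos
      nlinarith [sq_nonneg (w.re + w.im), mul_nonneg this.le (sq_nonneg (w.re + w.im))]
    have hp := lineConst_pos σ (2 * (t / (2 * Real.pi)) + (n + 1))
    set K := lineConst σ (2 * (t / (2 * Real.pi)) + (n + 1))
    have hnum' : ‖num (X w)‖ ≤ K * (2 ^ |σ| * (n + 1) ^ |σ|) := by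
      refine hnum.trans ?_
      calc _ ≤ K * (2 ^ |σ| * (n + 1) ^ |σ|) * 1 := by gcongr
        _ = _ := by ring
    have e2 : ‖auxIntegrand s (X w)‖ = ‖num (X w)‖ / ‖den (X w)‖ := by
      rw [auxIntegrand, norm_div]
    have hw2 : ‖w‖ / ‖den (X w)‖ ≤ 2 := by
      rw [div_le_iff₀ hdpos]
      have : 2 * |w.re + w.im| ≤ ‖den (X w)‖ := him
      linarith
    rw [e1, norm_mul, norm_mul, e2]
    calc _ = ‖w‖ / ‖den (X w)‖ * ‖num (X w)‖ * ‖1 + Complex.I‖ := by ring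
      _ ≤ 2 * (K * (2 ^ |σ| * (n + 1) ^ |σ|)) * 2 := by gcongr
      _ = _ := by ring
  have hline : ∀ β : ℝ, β ≠ 0 → ∀ u : ℝ,
      q ((u : ℂ) + (β : ℂ) * Complex.I) * ((u : ℂ) + (β : ℂ) * Complex.I)⁻¹ =
      auxIntegrand s (((n - 2 * β : ℝ) : ℂ) + (1 + Complex.I) * ((u + β : ℝ) : ℂ)) *
        (1 + Complex.I) := by
    intro β hβ u
    rw [hqf _ fun h => ?_, hX]
    · simp
    · have := congrArg Complex.im h
      simp at this
      exact hβ this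
  -- The two parametrizations of the line differ by a translation of `u`, which leaves the integral
  -- unchanged.
  have hlow : (fun u : ℝ => q ((u : ℂ) + ((-(1 / 4) : ℝ) : ℂ) * Complex.I) *
      ((u : ℂ) + ((-(1 / 4) : ℝ) : ℂ) * Complex.I)⁻¹) =
      fun u : ℝ => (fun u : ℝ => auxIntegrand s (((n + 1 / 2 : ℝ) : ℂ) + (1 + Complex.I) * u) *
        (1 + Complex.I)) (u + -(1 / 4)) := by
    funext u
    rw [hline _ (by norm_num) u]
    norm_num
  have hup : (fun u : ℝ => q ((u : ℂ) + ((1 / 4 : ℝ) : ℂ) * Complex.I) *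
      ((u : ℂ) + ((1 / 4 : ℝ) : ℂ) * Complex.I)⁻¹) =
      fun u : ℝ => (fun u : ℝ => auxIntegrand s (((n - 1 / 2 : ℝ) : ℂ) + (1 + Complex.I) * u) *
        (1 + Complex.I)) (u + 1 / 4) := by
    funext u
    rw [hline _ (by norm_num) u]
    norm_num
  have hi1 : Integrable fun u : ℝ => auxIntegrand s (((n + 1 / 2 : ℝ) : ℂ) + (1 + Complex.I) * u) *
      (1 + Complex.I) := (integrable_auxIntegrand_halfLine n σ ht).mul_const _
  have hi2 : Integrable fun u : ℝ => auxIntegrand s (((n - 1 / 2 : ℝ) : ℂ) + (1 + Complex.I) * u) *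
      (1 + Complex.I) := by
    have := (integrable_auxIntegrand_halfLine (n - 1) σ ht).mul_const (1 + Complex.I)
    have e : (((n - 1 : ℕ) : ℝ) + 1 / 2) = n - 1 / 2 := by
      rw [Nat.cast_sub hn]; push_cast; ring
    rwa [e] at this
  have hmain := integral_strip_sub (q := q) (b := 1 / 4) (by norm_num) hUo
    (fun w hw => lt_of_le_of_lt hw (by norm_num)) hqd hcell
    (by rw [hlow]; exact hi1.comp_add_right _) (by rw [hup]; exact hi2.comp_add_right _)
  rw [hlow, hup, integral_add_right_eq_self (fun u : ℝ => auxIntegrand s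
      (((n + 1 / 2 : ℝ) : ℂ) + (1 + Complex.I) * u) * (1 + Complex.I)),
    integral_add_right_eq_self (fun u : ℝ => auxIntegrand s
      (((n - 1 / 2 : ℝ) : ℂ) + (1 + Complex.I) * u) * (1 + Complex.I)), hq0] at hmain
  rw [auxLine, auxLine, sub_neg_eq_add, neg_add_eq_sub, hmain]
  field_simp

/-- The residues telescope. `N` is free, so the line can later be placed next to the saddle point
`√(t / 2π)`. -/
theorem auxR_eq_sum_add_auxLine (N : ℕ) (σ : ℝ) {t : ℝ} (ht : 0 ≤ t) :
    auxR ((σ : ℂ) + t * Complex.I) =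
      ∑ n ∈ Finset.Icc 1 N, (n : ℂ) ^ (-((σ : ℂ) + t * Complex.I)) +
        auxLine ((σ : ℂ) + t * Complex.I) (N + 1 / 2 : ℝ) := by
  induction N with
  | zero => rw [auxR_eq_auxLine]; simp
  | succ k ih =>
    rw [ih, Finset.sum_Icc_succ_top (by omega), ← auxLine_sub_auxLine (by omega) σ ht]
    have : (((k + 1 : ℕ) : ℝ) - 1 / 2) = k + 1 / 2 := by push_cast; ring
    rw [this]
    ring

/-! ### Polynomial growth, mean values and Laplace transforms -/

/-- Measurable functions that are polynomially bounded on `[1, ∞)`. -/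
structure Tame (h : ℝ → ℝ) : Prop where
  meas : Measurable h
  bdd : ∃ (C : ℝ) (k : ℕ), 0 ≤ C ∧ ∀ t : ℝ, 1 ≤ t → |h t| ≤ C * t ^ k

namespace Tame

variable {f g : ℝ → ℝ}

lemma const (c : ℝ) : Tame fun _ => c :=
  ⟨measurable_const, |c|, 0, abs_nonneg c, fun t _ => by simp⟩

lemma mono (hg : Tame g) (hf : Measurable f) (h : ∀ t : ℝ, 1 ≤ t → |f t| ≤ |g t|) : Tame f := by
  obtain ⟨C, k, hC, hb⟩ := hg.bdd
  exact ⟨hf, C, k, hC, fun t ht => (h t ht).trans (hb t ht)⟩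

lemma mul (hf : Tame f) (hg : Tame g) : Tame fun t => f t * g t := by
  obtain ⟨C, k, hC, hb⟩ := hf.bdd
  obtain ⟨C', k', hC', hb'⟩ := hg.bdd
  refine ⟨hf.meas.mul hg.meas, C * C', k + k', mul_nonneg hC hC', fun t ht => ?_⟩
  rw [abs_mul]
  calc |f t| * |g t| ≤ (C * t ^ k) * (C' * t ^ k') := by
        gcongr
        exacts [hb t ht, hb' t ht]
    _ = _ := by ring

lemma add (hf : Tame f) (hg : Tame g) : Tame fun t => f t + g t := by
  obtain ⟨C, k, hC, hb⟩ := hf.bdd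
  obtain ⟨C', k', hC', hb'⟩ := hg.bdd
  refine ⟨hf.meas.add hg.meas, C + C', k + k', add_nonneg hC hC', fun t ht => ?_⟩
  calc |f t + g t| ≤ C * t ^ k + C' * t ^ k' := (abs_add_le _ _).trans (add_le_add (hb t ht) (hb' t ht))
    _ ≤ C * t ^ (k + k') + C' * t ^ (k + k') := by
        gcongr <;> first | exact ht | omega
    _ = _ := by ring

lemma neg (hf : Tame f) : Tame fun t => -f t := by
  simpa using (const (-1)).mul hf

lemma sub (hf : Tame f) (hg : Tame g) : Tame fun t => f t - g t := by
  simpa [sub_eq_add_neg] using hf.add hg.neg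

lemma abs (hf : Tame f) : Tame fun t => |f t| :=
  hf.mono (by simpa using hf.meas.norm) fun t _ => by simp

lemma le_const (hf : Tame f) (T : ℝ) : ∃ C : ℝ, 0 ≤ C ∧ ∀ t : ℝ, 1 ≤ t → t ≤ T → |f t| ≤ C := by
  obtain ⟨C, k, hC, hb⟩ := hf.bdd
  refine ⟨C * |T| ^ k, by positivity, fun t ht htT => (hb t ht).trans ?_⟩
  gcongr
  exact htT.trans (le_abs_self T)

lemma integrableOn (hf : Tame f) (T : ℝ) : IntegrableOn f (Ioc 1 T) := by
  obtain ⟨C, hC, hb⟩ := hf.le_const T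
  refine Measure.integrableOn_of_bounded (M := C) (by simp) hf.meas.aestronglyMeasurable ?_
  filter_upwards [ae_restrict_mem measurableSet_Ioc] with t ht
  exact hb t ht.1.le ht.2

lemma intervalIntegrable (hf : Tame f) {T : ℝ} (hT : 1 ≤ T) : IntervalIntegrable f volume 1 T :=
  (intervalIntegrable_iff_integrableOn_Ioc_of_le hT).2 (hf.integrableOn T)

lemma integrableOn_mul_exp (hf : Tame f) {ε : ℝ} (hε : 0 < ε) :
    IntegrableOn (fun t => f t * Real.exp (-(ε * t))) (Ioi 1) := by
  obtain ⟨C, k, hC, hb⟩ := hf.bdd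
  have h1 : IntegrableOn (fun t : ℝ => t ^ (k : ℝ) * Real.exp (-ε * t)) (Ioi 0) :=
    integrableOn_rpow_mul_exp_neg_mul_rpow (p := 1) (s := k)
      (by linarith [(k : ℕ).cast_nonneg (α := ℝ)]) zero_lt_one hε |>.congr_fun
      (fun t _ => by simp) measurableSet_Ioi
  have h2 := (h1.mono_set (Ioi_subset_Ioi zero_le_one)).const_mul C
  refine Integrable.mono' h2 ?_ ?_
  · exact (hf.meas.mul (by fun_prop)).aestronglyMeasurable
  · filter_upwards [ae_restrict_mem measurableSet_Ioi] with t ht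
    have ht : 1 < t := ht
    rw [norm_mul, Real.norm_eq_abs, Real.norm_eq_abs, Real.abs_exp, Real.rpow_natCast, ← mul_assoc,
      neg_mul]
    gcongr
    exact hb t ht.le

end Tame

/-- The primitive of `h` vanishing at `1` is `o(T ^ (3 / 2))`. -/
def MeanNegligible (h : ℝ → ℝ) : Prop :=
  ∀ η : ℝ, 0 < η → ∃ C : ℝ, 0 ≤ C ∧
    ∀ T : ℝ, 1 ≤ T → |∫ t in (1 : ℝ)..T, h t| ≤ η * T ^ (3 / 2 : ℝ) + C * T

lemma MeanNegligible.add {f g : ℝ → ℝ} (hf : MeanNegligible f) (hg : MeanNegligible g)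
    (tf : Tame f) (tg : Tame g) : MeanNegligible fun t => f t + g t := by
  intro η hη
  obtain ⟨C, hC, h1⟩ := hf (η / 2) (by positivity)
  obtain ⟨C', hC', h2⟩ := hg (η / 2) (by positivity)
  refine ⟨C + C', by positivity, fun T hT => ?_⟩
  rw [intervalIntegral.integral_add (tf.intervalIntegrable hT) (tg.intervalIntegrable hT)]
  refine (abs_add_le _ _).trans ?_
  linarith [h1 T hT, h2 T hT]

lemma mul_sqrt_eq_rpow {T : ℝ} (hT : 0 < T) : T * √T = T ^ (3 / 2 : ℝ) := by
  rw [Real.sqrt_eq_rpow, show (3 / 2 : ℝ) = 1 + 1 / 2 by norm_num, Real.rpow_add hT, Real.rpow_one]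

lemma integral_sqrt_le {T : ℝ} (hT : 1 ≤ T) : ∫ t in (1 : ℝ)..T, √t ≤ T ^ (3 / 2 : ℝ) := by
  have hT0 : 0 < T := by linarith
  have : ∫ t in (1 : ℝ)..T, √t ≤ ∫ t in (1 : ℝ)..T, √T := by
    refine intervalIntegral.integral_mono_on hT (Real.continuous_sqrt.intervalIntegrable _ _)
      (continuous_const.intervalIntegrable _ _) fun t ht => Real.sqrt_le_sqrt ht.2
  refine this.trans ?_
  rw [intervalIntegral.integral_const, smul_eq_mul, ← mul_sqrt_eq_rpow hT0]
  nlinarith [Real.sqrt_nonneg T]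

lemma abs_integral_le_of_abs_le {h : ℝ → ℝ} (th : Tame h) {η C : ℝ} (hη : 0 ≤ η) (hC : 0 ≤ C)
    (hb : ∀ t : ℝ, 1 ≤ t → |h t| ≤ η * √t + C) {T : ℝ} (hT : 1 ≤ T) :
    |∫ t in (1 : ℝ)..T, h t| ≤ η * T ^ (3 / 2 : ℝ) + C * T := by
  have h1 : |∫ t in (1 : ℝ)..T, h t| ≤ ∫ t in (1 : ℝ)..T, |h t| :=
    intervalIntegral.abs_integral_le_integral_abs hT
  have i1 : IntervalIntegrable (fun t => η * √t) volume 1 T :=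
    (continuous_const.mul Real.continuous_sqrt).intervalIntegrable _ _
  have h2 : ∫ t in (1 : ℝ)..T, |h t| ≤ ∫ t in (1 : ℝ)..T, (η * √t + C) :=
    intervalIntegral.integral_mono_on hT (th.abs.intervalIntegrable hT)
      (i1.add (continuous_const.intervalIntegrable _ _)) fun t ht => hb t ht.1
  rw [intervalIntegral.integral_add i1 (continuous_const.intervalIntegrable _ _),
    intervalIntegral.integral_const_mul, intervalIntegral.integral_const, smul_eq_mul] at h2
  have := mul_le_mul_of_nonneg_left (integral_sqrt_le hT) hη
  nlinarith

/-- Beyond some `T₀` the function is at most `η √t`; before `T₀` it is bounded, and the bound goes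
into the term `C T`. -/
lemma MeanNegligible.of_tendsto {h : ℝ → ℝ} (th : Tame h)
    (ht : Tendsto (fun t => h t / √t) atTop (𝓝 0)) : MeanNegligible h := by
  intro η hη
  have h1 := (Metric.tendsto_nhds.1 ht η hη)
  obtain ⟨T₀, hT₀⟩ := eventually_atTop.1 h1
  obtain ⟨C, hC, hb⟩ := th.le_const T₀
  refine ⟨C, hC, fun T hT => abs_integral_le_of_abs_le th hη.le hC (fun t ht => ?_) hT⟩
  rcases le_total t T₀ with h | h
  · have := hb t ht h
    have : 0 ≤ η * √t := by positivity
    linarith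
  · have h2 := hT₀ t h
    have h3 : 0 < √t := Real.sqrt_pos.2 (by linarith)
    rw [dist_zero_right, Real.norm_eq_abs, abs_div, abs_of_pos h3, div_lt_iff₀ h3] at h2
    linarith

/-- Integration by parts for a Laplace transform, in terms of the primitive of the function. -/
lemma integral_mul_exp_eq {g : ℝ → ℝ} (tg : Tame g) {ε : ℝ} (hε : 0 < ε) :
    ∫ t in Ioi (1 : ℝ), g t * Real.exp (-(ε * t)) =
      ∫ u in Ioi (1 : ℝ), (∫ t in (1 : ℝ)..u, g t) * (ε * Real.exp (-(ε * u))) := by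
  let μ : Measure ℝ := volume.restrict (Ioi 1)
  -- Fubini on `t < u`, starting from `e ^ (-ε t) = ∫_t^∞ ε e ^ (-ε u) du`.
  let F : ℝ → ℝ → ℝ := fun t u => (Ioi t).indicator (fun u => g t * (ε * Real.exp (-(ε * u)))) u
  have hmeas : Measurable (Function.uncurry F) := by
    have h1 : Measurable fun p : ℝ × ℝ => g p.1 * (ε * Real.exp (-(ε * p.2))) :=
      (tg.meas.comp measurable_fst).mul (by fun_prop)
    have h2 : MeasurableSet {p : ℝ × ℝ | p.1 < p.2} := measurableSet_lt measurable_fst measurable_snd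
    convert h1.indicator h2 using 1
    ext ⟨t, u⟩
    simp [F, Function.uncurry, indicator]
  -- For `t < u` the exponential `e ^ (-ε u)` is at most `e ^ (-ε t / 2) e ^ (-ε u / 2)`, which
  -- separates the variables.
  have hdom : Integrable (fun p : ℝ × ℝ => (g p.1 * Real.exp (-(ε / 2 * p.1))) *
      (ε * Real.exp (-(ε / 2 * p.2)))) (μ.prod μ) := by
    refine Integrable.mul_prod (f := fun t => g t * Real.exp (-(ε / 2 * t)))
      (g := fun u => ε * Real.exp (-(ε / 2 * u))) (tg.integrableOn_mul_exp (by positivity)) ?_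
    exact (Tame.const ε).integrableOn_mul_exp (by positivity)
  have hint : Integrable (Function.uncurry F) (μ.prod μ) := by
    refine hdom.mono hmeas.aestronglyMeasurable (Eventually.of_forall fun p => ?_)
    rcases p with ⟨t, u⟩
    simp only [Function.uncurry, F, indicator, mem_Ioi]
    split_ifs with h
    · have h1 : Real.exp (-(ε * u)) ≤ Real.exp (-(ε / 2 * t)) * Real.exp (-(ε / 2 * u)) := by
        rw [← Real.exp_add, Real.exp_le_exp]
        nlinarith
      simp only [norm_mul, Real.norm_eq_abs, Real.abs_exp]
      calc |g t| * (|ε| * Real.exp (-(ε * u))) ≤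
          |g t| * (|ε| * (Real.exp (-(ε / 2 * t)) * Real.exp (-(ε / 2 * u)))) := by gcongr
        _ = _ := by ring
    · simp only [norm_zero]; positivity
  have hswap := integral_integral_swap hint
  have hl : ∀ t ∈ Ioi (1 : ℝ), ∫ u, F t u ∂μ = g t * Real.exp (-(ε * t)) := by
    intro t ht
    have ht : 1 < t := ht
    simp only [F, μ]
    rw [setIntegral_indicator measurableSet_Ioi, Ioi_inter_Ioi, max_eq_right ht.le,
      integral_const_mul, integral_const_mul]
    have := integral_exp_mul_Ioi (a := -ε) (by linarith) t
    simp only [neg_mul] at this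
    rw [this]
    field_simp
  have hr : ∀ u ∈ Ioi (1 : ℝ), ∫ t, F t u ∂μ = (∫ t in (1 : ℝ)..u, g t) * (ε * Real.exp (-(ε * u))) := by
    intro u hu
    have hu : 1 < u := hu
    have : (fun t => F t u) = (Iio u).indicator fun t => g t * (ε * Real.exp (-(ε * u))) := by
      funext t
      simp [F, indicator]
    simp only [μ]
    rw [this, setIntegral_indicator measurableSet_Iio, Ioi_inter_Iio,
      ← integral_Ioc_eq_integral_Ioo, integral_mul_const, intervalIntegral.integral_of_le hu.le]
  rw [← setIntegral_congr_fun measurableSet_Ioi hl, ← setIntegral_congr_fun measurableSet_Ioi hr]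
  exact hswap

lemma setIntegral_Ioi_rpow_mul_exp {a ε : ℝ} (ha : 0 < a) (hε : 0 < ε) :
    IntegrableOn (fun t : ℝ => t ^ (a - 1) * Real.exp (-(ε * t))) (Ioi 0) ∧
    ∫ t in Ioi (0 : ℝ), t ^ (a - 1) * Real.exp (-(ε * t)) = ε ^ (-a) * Real.Gamma a := by
  constructor
  · exact integrableOn_rpow_mul_exp_neg_mul_rpow (p := 1) (s := a - 1)
      (by linarith) zero_lt_one hε |>.congr_fun (fun t _ => by simp) measurableSet_Ioi
  · rw [Real.integral_rpow_mul_exp_neg_mul_Ioi ha hε, one_div, Real.inv_rpow hε.le,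
      Real.rpow_neg hε.le]

lemma setIntegral_Ioi_one_rpow_mul_exp_le {a ε : ℝ} (ha : 0 < a) (hε : 0 < ε) :
    ∫ t in Ioi (1 : ℝ), t ^ (a - 1) * Real.exp (-(ε * t)) ≤ ε ^ (-a) * Real.Gamma a := by
  obtain ⟨hi, he⟩ := setIntegral_Ioi_rpow_mul_exp ha hε
  rw [← he]
  refine setIntegral_mono_set hi ?_ (Ioi_subset_Ioi zero_le_one).eventuallyLE
  filter_upwards [ae_restrict_mem measurableSet_Ioi] with t ht
  have ht : 0 < t := ht
  simp only [Pi.zero_apply]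
  positivity

/-- The Laplace transform of a mean-negligible function is `o(ε ^ (-3/2))`. -/
theorem MeanNegligible.abs_laplace_le {g : ℝ → ℝ} (hg : MeanNegligible g) (tg : Tame g)
    {η : ℝ} (hη : 0 < η) : ∃ C : ℝ, 0 ≤ C ∧ ∀ ε : ℝ, 0 < ε →
      |∫ t in Ioi (1 : ℝ), g t * Real.exp (-(ε * t))| ≤ η * ε ^ (-(3 / 2) : ℝ) + C * ε ^ (-1 : ℝ) := by
  have hΓ : 0 < Real.Gamma (5 / 2) := Real.Gamma_pos_of_pos (by norm_num)
  -- The transform of `u ^ (3 / 2)` brings in `Γ(5 / 2)`, which is divided out beforehand. The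
  -- linear term brings in `Γ(2) = 1`.
  obtain ⟨C, hC, hb⟩ := hg (η / Real.Gamma (5 / 2)) (by positivity)
  refine ⟨C, hC, fun ε hε => ?_⟩
  rw [integral_mul_exp_eq tg hε]
  set η' := η / Real.Gamma (5 / 2)
  have i1 := (setIntegral_Ioi_rpow_mul_exp (a := 5 / 2) (by norm_num) hε).1.mono_set
    (Ioi_subset_Ioi zero_le_one)
  have i2 := (setIntegral_Ioi_rpow_mul_exp (a := 2) (by norm_num) hε).1.mono_set
    (Ioi_subset_Ioi zero_le_one)
  have b1 := setIntegral_Ioi_one_rpow_mul_exp_le (a := 5 / 2) (by norm_num) hε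
  have b2 := setIntegral_Ioi_one_rpow_mul_exp_le (a := 2) (by norm_num) hε
  rw [← Real.norm_eq_abs]
  calc _ ≤ ∫ u in Ioi (1 : ℝ), (ε * η' * (u ^ ((5 / 2 : ℝ) - 1) * Real.exp (-(ε * u))) +
        ε * C * (u ^ ((2 : ℝ) - 1) * Real.exp (-(ε * u)))) := by
        refine norm_integral_le_of_norm_le ((i1.const_mul _).add (i2.const_mul _)) ?_
        filter_upwards [ae_restrict_mem measurableSet_Ioi] with u hu
        have hu : 1 < u := hu
        have := hb u hu.le
        rw [norm_mul, Real.norm_eq_abs, Real.norm_eq_abs, abs_of_pos (by positivity : 0 <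
          ε * Real.exp (-(ε * u)))]
        have e1 : (5 / 2 : ℝ) - 1 = 3 / 2 := by norm_num
        have e2 : u ^ ((2 : ℝ) - 1) = u := by norm_num
        rw [e1, e2]
        calc _ ≤ (η' * u ^ (3 / 2 : ℝ) + C * u) * (ε * Real.exp (-(ε * u))) := by gcongr
          _ = _ := by ring
    _ = ε * η' * (∫ u in Ioi (1 : ℝ), u ^ ((5 / 2 : ℝ) - 1) * Real.exp (-(ε * u))) +
        ε * C * ∫ u in Ioi (1 : ℝ), u ^ ((2 : ℝ) - 1) * Real.exp (-(ε * u)) := by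
        rw [integral_add (i1.const_mul _) (i2.const_mul _), integral_const_mul, integral_const_mul]
    _ ≤ ε * η' * (ε ^ (-(5 / 2) : ℝ) * Real.Gamma (5 / 2)) +
        ε * C * (ε ^ (-2 : ℝ) * Real.Gamma 2) := by
        have : 0 < η' := by positivity
        gcongr
    _ = η * ε ^ (-(3 / 2) : ℝ) + C * ε ^ (-1 : ℝ) := by
        have e1 : ε ^ (-(3 / 2) : ℝ) = ε * ε ^ (-(5 / 2) : ℝ) := by
          rw [show (-(3 / 2) : ℝ) = 1 + -(5 / 2) by norm_num, Real.rpow_add hε, Real.rpow_one]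
        have e2 : ε ^ (-1 : ℝ) = ε * ε ^ (-2 : ℝ) := by
          rw [show (-1 : ℝ) = 1 + -2 by norm_num, Real.rpow_add hε, Real.rpow_one]
        rw [e1, e2, Real.Gamma_two]
        simp only [η']
        field_simp

/-! ### The approximate formula -/

/-- The number `⌊√(t / 2π)⌋` of terms in the approximate formula. -/
noncomputable def cutoff (t : ℝ) : ℕ := ⌊√(t / (2 * Real.pi))⌋₊

lemma measurable_cutoff : Measurable cutoff :=
  Nat.measurable_floor.comp (by fun_prop)

lemma cutoff_le (t : ℝ) : (cutoff t : ℝ) ≤ √(t / (2 * Real.pi)) :=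
  Nat.floor_le (Real.sqrt_nonneg _)

/-- This identifies the time from which the term `n` is present in the main sum. -/
lemma le_cutoff_iff {n : ℕ} {t : ℝ} (ht : 0 ≤ t) : n ≤ cutoff t ↔ 2 * Real.pi * (n : ℝ) ^ 2 ≤ t := by
  rw [cutoff, Nat.le_floor_iff (Real.sqrt_nonneg _), Real.le_sqrt (by positivity),
    le_div_iff₀ (by positivity), mul_comm]
  positivity

lemma cutoff_mono {t T : ℝ} (h : t ≤ T) : cutoff t ≤ cutoff T := by
  unfold cutoff
  gcongr

lemma sqrt_div_two_pi_le {t : ℝ} (ht : 0 ≤ t) : √(t / (2 * Real.pi)) ≤ √t := by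
  apply Real.sqrt_le_sqrt
  apply div_le_self ht
  linarith [Real.pi_gt_three]

lemma cutoff_le_self {t : ℝ} (ht : 1 ≤ t) : (cutoff t : ℝ) ≤ t := by
  refine (cutoff_le t).trans ((sqrt_div_two_pi_le (by linarith)).trans ?_)
  rw [Real.sqrt_le_iff]
  constructor <;> nlinarith

lemma one_third_le_sqrt {t : ℝ} (ht : 1 ≤ t) : 1 / 3 ≤ √(t / (2 * Real.pi)) := by
  apply Real.le_sqrt_of_sq_le
  rw [le_div_iff₀ (by positivity)]
  linarith [Real.pi_lt_four]

lemma div_two_pi_rpow {t : ℝ} (ht : 0 ≤ t) (σ : ℝ) :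
    (t / (2 * Real.pi)) ^ σ = √(t / (2 * Real.pi)) ^ (2 * σ) := by
  rw [Real.rpow_mul (Real.sqrt_nonneg _), Real.rpow_two, Real.sq_sqrt (by positivity)]

lemma rpow_neg_mul_rpow_le {x y : ℝ} (hx : 0 < x) (hy : 0 < y) (hxy : x ≤ 3 * y) (hyx : y ≤ 3 * x)
    (p : ℝ) : x ^ (-p) * y ^ p ≤ 3 ^ |p| := by
  have h : x ^ (-p) * y ^ p = (y / x) ^ p := by
    rw [Real.div_rpow hy.le hx.le, Real.rpow_neg hx.le]
    field_simp
  rw [h]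
  rcases le_total 0 p with hp | hp
  · rw [abs_of_nonneg hp]
    refine Real.rpow_le_rpow (by positivity) ?_ hp
    rwa [div_le_iff₀ hx]
  · rw [abs_of_nonpos hp, ← inv_div, Real.inv_rpow (by positivity), ← Real.rpow_neg (by positivity)]
    refine Real.rpow_le_rpow (by positivity) ?_ (by linarith)
    rwa [div_le_iff₀ hy]

/-- The main sum of the approximate formula for `auxR`. -/
noncomputable def mainSum (σ t : ℝ) : ℂ :=
  ∑ n ∈ Finset.Icc 1 (cutoff t), (n : ℂ) ^ (-((σ : ℂ) + t * Complex.I))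

/-- The approximate formula for `auxR`, with remainder `O(t ^ (-σ / 2))`. -/
theorem exists_norm_auxR_sub_mainSum_le (σ : ℝ) : ∃ K : ℝ, 0 ≤ K ∧ ∀ t : ℝ, 1 ≤ t →
    ‖auxR ((σ : ℂ) + t * Complex.I) - mainSum σ t‖ ^ 2 * (t / (2 * Real.pi)) ^ σ ≤ K := by
  refine ⟨(2 * lineConst σ (3 / 2)) ^ 2 * 3 ^ |2 * σ|, by positivity, fun t ht => ?_⟩
  have ht0 : 0 ≤ t := by linarith
  set a := √(t / (2 * Real.pi)) with ha
  have ha2 : t / (2 * Real.pi) = a ^ 2 := (Real.sq_sqrt (by positivity)).symm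
  have ha3 : 1 / 3 ≤ a := one_third_le_sqrt ht
  set N := cutoff t with hN
  have h1 : (N : ℝ) ≤ a := cutoff_le t
  have h2 : a < N + 1 := Nat.lt_floor_add_one a
  have hN0 : (0 : ℝ) ≤ N := N.cast_nonneg
  have hc : (0 : ℝ) < N + 1 / 2 := by positivity
  -- With `c = N + 1 / 2` one has `a² / c - c = (a - c)(a + c) / c`, where `|a - c| ≤ 1 / 2` and `a
  -- + c ≤ 2c + 1 / 2 ≤ 3c`.
  have hB : |t / (2 * Real.pi) / (N + 1 / 2 : ℝ) - (N + 1 / 2 : ℝ)| ≤ 3 / 2 := by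
    rw [ha2]
    set c : ℝ := N + 1 / 2
    have hc2 : 1 / 2 ≤ c := by simp only [c]; linarith
    have e : a ^ 2 / c - c = (a - c) * (a + c) / c := by field_simp; ring
    have h3 : a - c ≤ 1 / 2 := by simp only [c]; linarith
    have h4 : -(1 / 2) ≤ a - c := by simp only [c]; linarith
    rw [e, abs_div, abs_mul, abs_of_pos hc, div_le_iff₀ hc, abs_of_pos (by linarith : 0 < a + c)]
    have h5 : |a - c| ≤ 1 / 2 := abs_le.2 ⟨h4, h3⟩
    nlinarith [abs_nonneg (a - c)]
  have hR := norm_auxLine_le (σ := σ) ht0 hB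
  rw [auxR_eq_sum_add_auxLine N σ ht0, mainSum, ← hN, add_sub_cancel_left, div_two_pi_rpow ht0, ← ha]
  have e : ((N + 1 / 2 : ℝ) ^ (-σ)) ^ 2 = (N + 1 / 2 : ℝ) ^ (-(2 * σ)) := by
    rw [← Real.rpow_natCast, ← Real.rpow_mul hc.le]
    congr 1; push_cast; ring
  calc _ ≤ (2 * lineConst σ (3 / 2) * (N + 1 / 2 : ℝ) ^ (-σ)) ^ 2 * a ^ (2 * σ) := by gcongr
    _ = (2 * lineConst σ (3 / 2)) ^ 2 * ((N + 1 / 2 : ℝ) ^ (-(2 * σ)) * a ^ (2 * σ)) := by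
        rw [mul_pow, e]; ring
    _ ≤ _ := by
        gcongr
        exact rpow_neg_mul_rpow_le hc (by linarith) (by linarith) (by linarith) _

/-! ### The square of the main sum: diagonal and off-diagonal parts -/

lemma natCast_cpow_re_im {n : ℕ} (hn : 1 ≤ n) (σ t : ℝ) :
    ((n : ℂ) ^ (-((σ : ℂ) + t * Complex.I))).re = (n : ℝ) ^ (-σ) * Real.cos (Real.log n * t) ∧
    ((n : ℂ) ^ (-((σ : ℂ) + t * Complex.I))).im = -((n : ℝ) ^ (-σ) * Real.sin (Real.log n * t)) := by
  have hn0 : (n : ℂ) ≠ 0 := by exact_mod_cast (by omega : n ≠ 0)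
  have hn1 : (0 : ℝ) < n := by exact_mod_cast hn
  rw [Complex.cpow_def_of_ne_zero hn0, ← Complex.natCast_log, Complex.exp_re, Complex.exp_im,
    Real.rpow_def_of_pos hn1]
  generalize Real.log n = L
  simp

lemma norm_sum_cpow_sq (M : ℕ) (σ t : ℝ) :
    ‖∑ n ∈ Finset.Icc 1 M, (n : ℂ) ^ (-((σ : ℂ) + t * Complex.I))‖ ^ 2 =
      ∑ m ∈ Finset.Icc 1 M, ∑ n ∈ Finset.Icc 1 M,
        (m : ℝ) ^ (-σ) * (n : ℝ) ^ (-σ) * Real.cos ((Real.log m - Real.log n) * t) := by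
  rw [← Complex.normSq_eq_norm_sq, Complex.normSq_apply, Complex.re_sum, Complex.im_sum,
    Finset.sum_mul_sum, Finset.sum_mul_sum, ← Finset.sum_add_distrib]
  refine Finset.sum_congr rfl fun m hm => ?_
  rw [← Finset.sum_add_distrib]
  refine Finset.sum_congr rfl fun n hn => ?_
  obtain ⟨h1, h2⟩ := natCast_cpow_re_im (Finset.mem_Icc.1 hm).1 σ t
  obtain ⟨h3, h4⟩ := natCast_cpow_re_im (Finset.mem_Icc.1 hn).1 σ t
  rw [h1, h2, h3, h4, sub_mul, Real.cos_sub]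
  ring

/-- The diagonal part of `‖mainSum σ t‖ ^ 2`. -/
noncomputable def diagSum (σ t : ℝ) : ℝ := ∑ n ∈ Finset.Icc 1 (cutoff t), (n : ℝ) ^ (-(2 * σ))

/-- The off-diagonal part of `‖mainSum σ t‖ ^ 2`. -/
noncomputable def offDiagSum (σ t : ℝ) : ℝ :=
  ∑ p ∈ (Finset.Icc 1 (cutoff t)).offDiag, (p.1 : ℝ) ^ (-σ) * (p.2 : ℝ) ^ (-σ) *
    Real.cos ((Real.log p.1 - Real.log p.2) * t)

lemma norm_mainSum_sq (σ t : ℝ) : ‖mainSum σ t‖ ^ 2 = diagSum σ t + offDiagSum σ t := by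
  rw [mainSum, norm_sum_cpow_sq, ← Finset.sum_product', ← Finset.diag_union_offDiag,
    Finset.sum_union (Finset.disjoint_diag_offDiag _), Finset.sum_diag, diagSum, offDiagSum]
  congr 1
  refine Finset.sum_congr rfl fun n hn => ?_
  have hn1 : (0 : ℝ) < n := by exact_mod_cast (Finset.mem_Icc.1 hn).1
  rw [sub_self, zero_mul, Real.cos_zero, mul_one, ← Real.rpow_add hn1]
  ring_nf

/-! ### Off-diagonal terms -/

/-- Integration by parts. The weight is monotone for either sign of `σ`, so its total variation is
`|u T - u A|`. Writing `u' = σ k` with `k ≥ 0` treats both signs at once. -/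
lemma abs_integral_cos_mul_rpow_le {A T : ℝ} (hA : 0 < A) (hAT : A ≤ T) {l : ℝ} (hl : l ≠ 0)
    (σ : ℝ) : |∫ t in A..T, Real.cos (l * t) * (t / (2 * Real.pi)) ^ σ| ≤
      2 * ((A / (2 * Real.pi)) ^ σ + (T / (2 * Real.pi)) ^ σ) / |l| := by
  have hpi : (0 : ℝ) < 2 * Real.pi := by positivity
  have hpos : ∀ t ∈ uIcc A T, 0 < t / (2 * Real.pi) := by
    intro t ht
    rw [uIcc_of_le hAT] at ht
    have : 0 < t := hA.trans_le ht.1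
    positivity
  set u : ℝ → ℝ := fun t => (t / (2 * Real.pi)) ^ σ with hu
  set k : ℝ → ℝ := fun t => 1 / (2 * Real.pi) * (t / (2 * Real.pi)) ^ (σ - 1) with hk
  have hkc : ContinuousOn k (uIcc A T) := by
    refine ContinuousOn.mul continuousOn_const (ContinuousOn.rpow_const (by fun_prop) ?_)
    exact fun t ht => Or.inl (hpos t ht).ne'
  have hdu : ∀ t ∈ uIcc A T, HasDerivAt u (σ * k t) t := by
    intro t ht
    have := ((hasDerivAt_id t).div_const (2 * Real.pi)).rpow_const (p := σ) (Or.inl (hpos t ht).ne')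
    refine this.congr_deriv ?_
    simp only [hk, id]; ring
  have hdv : ∀ t ∈ uIcc A T, HasDerivAt (fun t => Real.sin (l * t) / l) (Real.cos (l * t)) t := by
    intro t _
    refine ((((hasDerivAt_id t).const_mul l).sin).div_const l).congr_deriv ?_
    simp only [id]; field_simp
  have hik : IntervalIntegrable k volume A T := hkc.intervalIntegrable
  have hparts := intervalIntegral.integral_mul_deriv_eq_deriv_mul hdu hdv (hik.const_mul σ)
    ((by fun_prop : Continuous fun t => Real.cos (l * t)).intervalIntegrable _ _)
  have hku : σ * ∫ t in A..T, k t = u T - u A := by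
    rw [← intervalIntegral.integral_const_mul]
    exact intervalIntegral.integral_eq_sub_of_hasDerivAt hdu (hik.const_mul σ)
  have hk0 : 0 ≤ ∫ t in A..T, k t := by
    refine intervalIntegral.integral_nonneg hAT fun t ht => ?_
    have := hpos t (by rwa [uIcc_of_le hAT])
    simp only [hk]; positivity
  have hsin : ∀ t, |Real.sin (l * t) / l| ≤ 1 / |l| := by
    intro t
    rw [abs_div]
    gcongr
    exact Real.abs_sin_le_one _
  have huA : 0 < u A := Real.rpow_pos_of_pos (hpos A left_mem_uIcc) _
  have huT : 0 < u T := Real.rpow_pos_of_pos (hpos T right_mem_uIcc) _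
  have hrest : |∫ t in A..T, σ * k t * (Real.sin (l * t) / l)| ≤ (u A + u T) / |l| := by
    calc |∫ t in A..T, σ * k t * (Real.sin (l * t) / l)| ≤
        ∫ t in A..T, |σ| * (1 / |l|) * k t := by
          rw [← Real.norm_eq_abs]
          refine intervalIntegral.norm_integral_le_of_norm_le hAT ?_ (hik.const_mul _)
          refine Eventually.of_forall fun t ht => ?_
          have := hpos t (by rw [uIcc_of_le hAT]; exact Ioc_subset_Icc_self ht)
          have hkt : 0 ≤ k t := by simp only [hk]; positivity
          rw [norm_mul, norm_mul, Real.norm_eq_abs, Real.norm_eq_abs, Real.norm_eq_abs,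
            abs_of_nonneg hkt]
          calc |σ| * k t * |Real.sin (l * t) / l| ≤ |σ| * k t * (1 / |l|) := by
                gcongr
                exact hsin t
            _ = _ := by ring
      _ = |σ * ∫ t in A..T, k t| * (1 / |l|) := by
          rw [intervalIntegral.integral_const_mul, abs_mul, abs_of_nonneg hk0]; ring
      _ ≤ (u A + u T) * (1 / |l|) := by
          rw [hku]
          gcongr
          rw [abs_le]
          constructor <;> linarith
      _ = _ := by ring
  have e : ∫ t in A..T, Real.cos (l * t) * u t = ∫ t in A..T, u t * Real.cos (l * t) :=
    intervalIntegral.integral_congr fun t _ => mul_comm _ _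
  rw [e, hparts]
  have b1 : |u T * (Real.sin (l * T) / l)| ≤ u T / |l| := by
    rw [abs_mul, abs_of_pos huT, div_eq_mul_one_div (u T)]
    gcongr
    exact hsin T
  have b2 : |u A * (Real.sin (l * A) / l)| ≤ u A / |l| := by
    rw [abs_mul, abs_of_pos huA, div_eq_mul_one_div (u A)]
    gcongr
    exact hsin A
  calc _ ≤ u T / |l| + u A / |l| + (u A + u T) / |l| := by
        refine (abs_sub _ _).trans (add_le_add ((abs_sub _ _).trans (add_le_add b1 b2)) hrest)
    _ = _ := by ring

/-- Enlarging the square by one row and one column adds two harmonic numbers. The diagonal adds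
nothing, since the inverse of `0` is `0`. The logarithm is kept at the final `M` during the
induction. -/
lemma sum_range_inv_abs_sub_le (M : ℕ) :
    ∑ m ∈ Finset.range M, ∑ n ∈ Finset.range M, |(m : ℝ) - n|⁻¹ ≤ 2 * M * (1 + Real.log M) := by
  have h1 : ∀ M : ℕ, ∑ n ∈ Finset.range M, |(M : ℝ) - n|⁻¹ = (harmonic M : ℝ) := by
    intro M
    rw [harmonic, ← Finset.sum_range_reflect]
    push_cast
    refine Finset.sum_congr rfl fun n hn => ?_
    have hn := Finset.mem_range.1 hn
    have e : ((M - 1 - n : ℕ) : ℝ) = M - 1 - n := by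
      rw [Nat.cast_sub (by omega), Nat.cast_sub (by omega)]; simp
    rw [e, abs_of_nonneg (by linarith [(Nat.cast_nonneg n : (0 : ℝ) ≤ n)])]
    ring_nf
  have h2 : ∀ K : ℕ, K ≤ M →
      ∑ m ∈ Finset.range K, ∑ n ∈ Finset.range K, |(m : ℝ) - n|⁻¹ ≤ 2 * K * (1 + Real.log M) := by
    intro K
    induction K with
    | zero => simp
    | succ K ih =>
      intro hK
      have ih := ih (by omega)
      rw [Finset.sum_range_succ]
      simp_rw [Finset.sum_range_succ]
      rw [Finset.sum_add_distrib, h1]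
      have e : ∑ x ∈ Finset.range K, |(x : ℝ) - K|⁻¹ = (harmonic K : ℝ) := by
        rw [← h1]
        exact Finset.sum_congr rfl fun n _ => by rw [abs_sub_comm]
      have hh : (harmonic K : ℝ) ≤ 1 + Real.log M := by
        rcases Nat.eq_zero_or_pos K with rfl | hK0
        · have : 0 ≤ Real.log M := Real.log_natCast_nonneg M
          simp; linarith
        · refine (harmonic_le_one_add_log K).trans ?_
          gcongr
          omega
      rw [e]
      push_cast
      simp only [sub_self, abs_zero, inv_zero]
      linarith
  exact h2 M le_rfl

/-- For `n < m`, `log (m / n) ≥ 1 - n / m = (m - n) / m`. -/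
lemma inv_abs_log_sub_log_le {m n : ℕ} (hm : 1 ≤ m) (hn : 1 ≤ n) (hmn : m ≠ n) :
    0 < |Real.log m - Real.log n| ∧
    |Real.log m - Real.log n|⁻¹ ≤ (max m n : ℕ) * |(m : ℝ) - n|⁻¹ := by
  wlog h : n < m generalizing m n
  · have := this hn hm hmn.symm (by omega)
    rwa [abs_sub_comm (Real.log n), abs_sub_comm (n : ℝ), max_comm] at this
  have hn0 : (0 : ℝ) < n := by exact_mod_cast hn
  have hm0 : (0 : ℝ) < m := by exact_mod_cast hm
  have hnm : (n : ℝ) < m := by exact_mod_cast h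
  rw [max_eq_left h.le, abs_of_pos (by linarith : (0 : ℝ) < m - n)]
  have hlog : ((m : ℝ) - n) / m ≤ Real.log m - Real.log n := by
    have := Real.one_sub_inv_le_log_of_pos (by positivity : (0 : ℝ) < m / n)
    rw [Real.log_div hm0.ne' hn0.ne', inv_div] at this
    convert this using 1
    field_simp
  have hpos : 0 < ((m : ℝ) - n) / m := div_pos (by linarith) hm0
  rw [abs_of_pos (hpos.trans_le hlog)]
  refine ⟨hpos.trans_le hlog, ?_⟩
  refine (inv_anti₀ hpos hlog).trans (le_of_eq ?_)
  rw [inv_div, div_eq_mul_inv]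

/-- The logarithm is `o(x ^ (1 - τ))`. The left side is the shape of the total off-diagonal
estimate. -/
lemma exists_log_bound {τ : ℝ} (hτ : τ < 1) {η : ℝ} (hη : 0 < η) :
    ∃ C : ℝ, 0 ≤ C ∧ ∀ x : ℝ, 1 ≤ x →
      16 * x ^ (2 + τ) * (1 + Real.log (2 * x)) ≤ η * x ^ (3 : ℝ) + C := by
  have h1 : Tendsto (fun x : ℝ => (1 + Real.log (2 * x)) / x ^ (1 - τ)) atTop (𝓝 0) := by
    have ha : Tendsto (fun x : ℝ => x ^ (1 - τ)) atTop atTop := tendsto_rpow_atTop (by linarith)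
    have hb : Tendsto (fun x : ℝ => Real.log x / x ^ (1 - τ)) atTop (𝓝 0) :=
      (isLittleO_log_rpow_atTop (by linarith)).tendsto_div_nhds_zero
    have hc := ((tendsto_const_nhds (x := 1 + Real.log 2)).div_atTop ha).add hb
    rw [add_zero] at hc
    refine hc.congr' ?_
    filter_upwards [eventually_gt_atTop 0] with x hx
    rw [Real.log_mul (by norm_num) hx.ne']
    ring
  obtain ⟨X, hX⟩ := eventually_atTop.1 ((tendsto_order.1 h1).2 (η / 16) (by positivity))
  have hlog : ∀ x : ℝ, 1 ≤ x → 0 ≤ Real.log (2 * x) := fun x hx => Real.log_nonneg (by linarith)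
  set Y := max X 1
  have hY : 1 ≤ Y := le_max_right _ _
  refine ⟨16 * Y ^ (3 : ℝ) * (1 + Real.log (2 * Y)), by have := hlog Y hY; positivity, fun x hx => ?_⟩
  have hx0 : 0 < x := by linarith
  rcases le_total X x with h | h
  · have h2 := hX x h
    rw [div_lt_iff₀ (by positivity)] at h2
    have e : x ^ (3 : ℝ) = x ^ (2 + τ) * x ^ (1 - τ) := by
      rw [← Real.rpow_add hx0]; ring_nf
    have h3 : 0 < x ^ (2 + τ) := by positivity
    have := hlog Y hY
    have h4 : 0 ≤ 16 * Y ^ (3 : ℝ) * (1 + Real.log (2 * Y)) := by positivity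
    rw [e]
    nlinarith
  · have hxY : x ≤ Y := h.trans (le_max_left _ _)
    have h2 : x ^ (2 + τ) ≤ Y ^ (3 : ℝ) :=
      (Real.rpow_le_rpow_of_exponent_le hx (by linarith)).trans
        (Real.rpow_le_rpow hx0.le hxY (by norm_num))
    have h3 : Real.log (2 * x) ≤ Real.log (2 * Y) := Real.log_le_log (by linarith) (by linarith)
    have h4 := hlog x hx
    have h5 : 0 ≤ η * x ^ (3 : ℝ) := by positivity
    calc 16 * x ^ (2 + τ) * (1 + Real.log (2 * x)) ≤
        16 * Y ^ (3 : ℝ) * (1 + Real.log (2 * Y)) := by gcongr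
      _ ≤ _ := by linarith

/-- A pair `(m, n)` occurs exactly when `t ≥ 2π max(m, n)²`. Exchanging sum and integral leaves an
oscillating integral from that time to `T`, and the two powers are the weight at its endpoints. -/
lemma abs_integral_offDiagSum_le {σ T : ℝ} (hT : 1 ≤ T) :
    |∫ t in (1 : ℝ)..T, offDiagSum σ t * (t / (2 * Real.pi)) ^ σ| ≤
      ∑ p ∈ (Finset.Icc 1 (cutoff T)).offDiag, (p.1 : ℝ) ^ (-σ) * (p.2 : ℝ) ^ (-σ) *
        (2 * (((max p.1 p.2 : ℕ) : ℝ) ^ (2 * σ) + √(T / (2 * Real.pi)) ^ (2 * σ)) *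
          ((max p.1 p.2 : ℕ) * |(p.1 : ℝ) - p.2|⁻¹)) := by
  set P := (Finset.Icc 1 (cutoff T)).offDiag with hP
  let h : ℕ × ℕ → ℝ → ℝ := fun p t => (p.1 : ℝ) ^ (-σ) * (p.2 : ℝ) ^ (-σ) *
    (Real.cos ((Real.log p.1 - Real.log p.2) * t) * (t / (2 * Real.pi)) ^ σ)
  let A : ℕ × ℕ → ℝ := fun p => 2 * Real.pi * ((max p.1 p.2 : ℕ) : ℝ) ^ 2
  have hmem : ∀ p ∈ P, 1 ≤ p.1 ∧ 1 ≤ p.2 ∧ p.1 ≠ p.2 ∧ max p.1 p.2 ≤ cutoff T := by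
    intro p hp
    simp only [hP, Finset.mem_offDiag, Finset.mem_Icc] at hp
    exact ⟨hp.1.1, hp.2.1.1, hp.2.2, max_le hp.1.2 hp.2.1.2⟩
  have hA : ∀ p ∈ P, 1 < A p ∧ A p ≤ T := by
    intro p hp
    obtain ⟨h1, h2, -, h4⟩ := hmem p hp
    refine ⟨?_, (le_cutoff_iff (by linarith)).1 h4⟩
    have : (1 : ℝ) ≤ (max p.1 p.2 : ℕ) := by exact_mod_cast h1.trans (le_max_left _ _)
    simp only [A]
    nlinarith [Real.pi_gt_three]
  have hcont : ∀ p, ContinuousOn (h p) (Icc 1 T) := by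
    intro p
    refine ContinuousOn.mul continuousOn_const (ContinuousOn.mul (by fun_prop) ?_)
    refine ContinuousOn.rpow_const (by fun_prop) fun t ht => Or.inl ?_
    have : 0 < t := by linarith [ht.1]
    positivity
  have hpt : ∀ t ∈ Ioc 1 T, offDiagSum σ t * (t / (2 * Real.pi)) ^ σ =
      ∑ p ∈ P, (Ici (A p)).indicator (h p) t := by
    intro t ht
    have hf : (Finset.Icc 1 (cutoff t)).offDiag = P.filter fun p => A p ≤ t := by
      have hle := cutoff_mono ht.2
      ext p
      have hAp : A p ≤ t ↔ max p.1 p.2 ≤ cutoff t := (le_cutoff_iff (by linarith [ht.1])).symm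
      rw [Finset.mem_filter, hAp, max_le_iff]
      simp only [hP, Finset.mem_offDiag, Finset.mem_Icc]
      constructor
      · rintro ⟨⟨a1, a2⟩, ⟨a3, a4⟩, a5⟩
        exact ⟨⟨⟨a1, a2.trans hle⟩, ⟨a3, a4.trans hle⟩, a5⟩, a2, a4⟩
      · rintro ⟨⟨⟨a1, _⟩, ⟨a3, _⟩, a5⟩, a2, a4⟩
        exact ⟨⟨a1, a2⟩, ⟨a3, a4⟩, a5⟩
    rw [offDiagSum, hf, Finset.sum_filter, Finset.sum_mul]
    refine Finset.sum_congr rfl fun p _ => ?_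
    simp only [indicator, mem_Ici, h]
    split_ifs <;> ring
  have hint : ∀ p ∈ P, IntegrableOn ((Ici (A p)).indicator (h p)) (Ioc 1 T) := fun p _ =>
    (((hcont p).integrableOn_Icc).mono_set Ioc_subset_Icc_self).indicator measurableSet_Ici
  rw [intervalIntegral.integral_of_le hT, setIntegral_congr_fun measurableSet_Ioc hpt,
    integral_finsetSum _ hint]
  refine (Finset.abs_sum_le_sum_abs _ _).trans (Finset.sum_le_sum fun p hp => ?_)
  obtain ⟨hA1, hAT⟩ := hA p hp
  obtain ⟨h1, h2, h3, h4⟩ := hmem p hp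
  have hset : Ioc 1 T ∩ Ici (A p) = Icc (A p) T := by
    ext t
    simp only [mem_inter_iff, mem_Ioc, mem_Ici, mem_Icc]
    constructor
    · rintro ⟨⟨_, a⟩, b⟩; exact ⟨b, a⟩
    · rintro ⟨a, b⟩; exact ⟨⟨by linarith, b⟩, a⟩
  obtain ⟨hl0, hl1⟩ := inv_abs_log_sub_log_le h1 h2 h3
  have hosc := abs_integral_cos_mul_rpow_le (by linarith) hAT (abs_pos.1 hl0) σ
  rw [setIntegral_indicator measurableSet_Ici, hset, integral_Icc_eq_integral_Ioc,
    ← intervalIntegral.integral_of_le hAT]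
  simp only [h]
  rw [intervalIntegral.integral_const_mul, abs_mul, abs_of_nonneg (by positivity)]
  refine mul_le_mul_of_nonneg_left (hosc.trans ?_) (by positivity)
  have e : (A p / (2 * Real.pi)) ^ σ = ((max p.1 p.2 : ℕ) : ℝ) ^ (2 * σ) := by
    simp only [A]
    rw [mul_div_cancel_left₀ _ (by positivity), Real.rpow_mul (by positivity), Real.rpow_two]
  rw [e, div_two_pi_rpow (by linarith), div_eq_mul_inv]
  gcongr

/-- For `σ ≥ 0` the factors in `m`, `n` are at most `1` and the weight is largest at `α`. For `σ ≤
0` those factors are at most `L ^ (-2σ)`, which cancels the weight `L ^ (2σ)`, now the larger of the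
two. -/
lemma offDiag_weight_le {m n : ℕ} {σ α : ℝ} (hm : 1 ≤ m) (hn : 1 ≤ n)
    (hα : ((max m n : ℕ) : ℝ) ≤ α) :
    (m : ℝ) ^ (-σ) * (n : ℝ) ^ (-σ) * (((max m n : ℕ) : ℝ) ^ (2 * σ) + α ^ (2 * σ)) ≤
      2 * α ^ (max (2 * σ) 0) := by
  set L : ℝ := ((max m n : ℕ) : ℝ) with hL
  have hm1 : (1 : ℝ) ≤ m := by exact_mod_cast hm
  have hn1 : (1 : ℝ) ≤ n := by exact_mod_cast hn
  have hmL : (m : ℝ) ≤ L := by rw [hL]; exact_mod_cast le_max_left _ _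
  have hnL : (n : ℝ) ≤ L := by rw [hL]; exact_mod_cast le_max_right _ _
  have hL0 : 0 < L := by linarith
  rcases le_total 0 σ with h | h
  · rw [max_eq_left (by linarith)]
    have h1 : (m : ℝ) ^ (-σ) ≤ 1 := Real.rpow_le_one_of_one_le_of_nonpos hm1 (by linarith)
    have h2 : (n : ℝ) ^ (-σ) ≤ 1 := Real.rpow_le_one_of_one_le_of_nonpos hn1 (by linarith)
    have h3 : L ^ (2 * σ) ≤ α ^ (2 * σ) := Real.rpow_le_rpow hL0.le hα (by linarith)
    have hα0 : 0 < α := by linarith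
    calc _ ≤ 1 * 1 * (α ^ (2 * σ) + α ^ (2 * σ)) := by gcongr
      _ = _ := by ring
  · rw [max_eq_right (by linarith), Real.rpow_zero]
    have h1 : (m : ℝ) ^ (-σ) ≤ L ^ (-σ) := Real.rpow_le_rpow (by linarith) hmL (by linarith)
    have h2 : (n : ℝ) ^ (-σ) ≤ L ^ (-σ) := Real.rpow_le_rpow (by linarith) hnL (by linarith)
    have h3 : α ^ (2 * σ) ≤ L ^ (2 * σ) := Real.rpow_le_rpow_of_nonpos hL0 hα (by linarith)
    have hα0 : 0 < α := by linarith
    calc _ ≤ L ^ (-σ) * L ^ (-σ) * (L ^ (2 * σ) + L ^ (2 * σ)) := by gcongr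
      _ = 2 * (L ^ (-σ) * L ^ (-σ) * L ^ (2 * σ)) := by ring
      _ = _ := by
          rw [← Real.rpow_add hL0, ← Real.rpow_add hL0]
          ring_nf
          simp

theorem meanNegligible_offDiagSum {σ : ℝ} (hσ : σ < 1 / 2) :
    MeanNegligible fun t => offDiagSum σ t * (t / (2 * Real.pi)) ^ σ := by
  intro η hη
  set τ := max (2 * σ) 0 with hτ
  -- The hypothesis `σ < 1 / 2` enters here: it keeps the total `α ^ (2 + τ) log α` below `α ^ 3`.
  have hτ1 : τ < 1 := max_lt (by linarith) one_pos
  obtain ⟨C, hC, hb⟩ := exists_log_bound hτ1 hη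
  refine ⟨C, hC, fun T hT => (abs_integral_offDiagSum_le hT).trans ?_⟩
  have hT0 : 0 < T := by linarith
  set α := √(T / (2 * Real.pi)) with hα
  have hMα : (cutoff T : ℝ) ≤ α := cutoff_le T
  rcases Nat.eq_zero_or_pos (cutoff T) with hM | hM
  · rw [hM]
    simp
    positivity
  have hα1 : 1 ≤ α := le_trans (by exact_mod_cast hM) hMα
  have hα0 : 0 < α := by linarith
  set M := cutoff T
  calc _ ≤ ∑ p ∈ (Finset.Icc 1 M).offDiag, 4 * α ^ (1 + τ) * |(p.1 : ℝ) - p.2|⁻¹ := by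
        refine Finset.sum_le_sum fun p hp => ?_
        simp only [Finset.mem_offDiag, Finset.mem_Icc] at hp
        have hL : ((max p.1 p.2 : ℕ) : ℝ) ≤ α := by
          refine le_trans ?_ hMα
          exact_mod_cast max_le hp.1.2 hp.2.1.2
        have hw := offDiag_weight_le (σ := σ) hp.1.1 hp.2.1.1 hL
        rw [← hτ] at hw
        have e : α ^ (1 + τ) = α * α ^ τ := by rw [Real.rpow_add hα0, Real.rpow_one]
        rw [e]
        calc _ = ((p.1 : ℝ) ^ (-σ) * (p.2 : ℝ) ^ (-σ) *
              (((max p.1 p.2 : ℕ) : ℝ) ^ (2 * σ) + α ^ (2 * σ))) *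
              (2 * (((max p.1 p.2 : ℕ) : ℝ) * |(p.1 : ℝ) - p.2|⁻¹)) := by ring
          _ ≤ (2 * α ^ τ) * (2 * (α * |(p.1 : ℝ) - p.2|⁻¹)) := by gcongr
          _ = _ := by ring
    _ = 4 * α ^ (1 + τ) * ∑ p ∈ (Finset.Icc 1 M).offDiag, |(p.1 : ℝ) - p.2|⁻¹ := by
        rw [Finset.mul_sum]
    _ ≤ 4 * α ^ (1 + τ) * (4 * α * (1 + Real.log (2 * α))) := by
        gcongr
        have h1 : (Finset.Icc 1 M).offDiag ⊆ Finset.range (M + 1) ×ˢ Finset.range (M + 1) := by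
          intro p hp
          simp only [Finset.mem_offDiag, Finset.mem_Icc] at hp
          simp only [Finset.mem_product, Finset.mem_range]
          omega
        have h2 := sum_range_inv_abs_sub_le (M + 1)
        have h3 : ((M + 1 : ℕ) : ℝ) ≤ 2 * α := by push_cast; linarith
        have h4 : (0 : ℝ) < ((M + 1 : ℕ) : ℝ) := by positivity
        have h5 : 0 ≤ Real.log ((M + 1 : ℕ) : ℝ) := Real.log_natCast_nonneg _
        calc _ ≤ ∑ p ∈ Finset.range (M + 1) ×ˢ Finset.range (M + 1), |(p.1 : ℝ) - p.2|⁻¹ :=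
              Finset.sum_le_sum_of_subset_of_nonneg h1 fun _ _ _ => by positivity
          _ ≤ 2 * (M + 1 : ℕ) * (1 + Real.log (M + 1 : ℕ)) := by
              rw [Finset.sum_product]; exact h2
          _ ≤ 2 * (2 * α) * (1 + Real.log (2 * α)) := by gcongr
          _ = _ := by ring
    _ = 16 * α ^ (2 + τ) * (1 + Real.log (2 * α)) := by
        have e : α ^ (2 + τ) = α * α ^ (1 + τ) := by
          rw [← Real.rpow_one_add' hα0.le (by
            have : 0 ≤ τ := le_max_right _ _
            positivity)]
          ring_nf
        rw [e]; ring
    _ ≤ η * α ^ (3 : ℝ) + C := hb α hα1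
    _ ≤ η * T ^ (3 / 2 : ℝ) + C * T := by
        have h1 : α ^ (3 : ℝ) ≤ T ^ (3 / 2 : ℝ) := by
          calc α ^ (3 : ℝ) ≤ (√T) ^ (3 : ℝ) :=
                Real.rpow_le_rpow hα0.le (sqrt_div_two_pi_le hT0.le) (by norm_num)
            _ = _ := by
                rw [Real.sqrt_eq_rpow, ← Real.rpow_mul hT0.le]; norm_num
        have h2 : C ≤ C * T := le_mul_of_one_le_right hC hT
        gcongr

/-! ### Diagonal terms -/

/-- A Stolz–Cesàro argument: the summands are compared with the increments `g` of `i ^ (p + 1)`,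
whose sums telescope and diverge. -/
lemma tendsto_sum_rpow_div {p : ℝ} (hp : -1 < p) :
    Tendsto (fun N : ℕ => (∑ n ∈ Finset.Icc 1 N, (n : ℝ) ^ p) / (N : ℝ) ^ (p + 1)) atTop
      (𝓝 (1 / (p + 1))) := by
  have hp1 : 0 < p + 1 := by linarith
  let g : ℕ → ℝ := fun i => ((i + 1 : ℕ) : ℝ) ^ (p + 1) - (i : ℝ) ^ (p + 1)
  have hsumg : ∀ N : ℕ, ∑ i ∈ Finset.range N, g i = (N : ℝ) ^ (p + 1) := by
    intro N
    rw [Finset.sum_range_sub fun i : ℕ => (i : ℝ) ^ (p + 1)]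
    simp [Real.zero_rpow hp1.ne']
  have hgpos : ∀ i, 0 < g i := fun i =>
    sub_pos.2 (Real.rpow_lt_rpow (by positivity) (by push_cast; linarith) hp1)
  -- The quotient is the slope of `x ^ (p + 1)` between `1` and `i / (i + 1)`, which tends to the
  -- derivative at `1`.
  have hratio : Tendsto (fun i : ℕ => g i / ((i + 1 : ℕ) : ℝ) ^ p) atTop (𝓝 (p + 1)) := by
    have hd : HasDerivAt (fun x : ℝ => x ^ (p + 1)) (p + 1) 1 := by
      simpa using Real.hasDerivAt_rpow_const (x := 1) (p := p + 1) (Or.inl one_ne_zero)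
    have hs := hasDerivAt_iff_tendsto_slope.1 hd
    have hu : Tendsto (fun i : ℕ => (i : ℝ) / ((i + 1 : ℕ) : ℝ)) atTop (𝓝[≠] 1) := by
      refine tendsto_nhdsWithin_iff.2 ⟨?_, Eventually.of_forall fun i => ?_⟩
      · simpa using tendsto_natCast_div_add_atTop (𝕜 := ℝ) 1
      · have : (0 : ℝ) < ((i + 1 : ℕ) : ℝ) := by positivity
        simp only [mem_compl_iff, mem_singleton_iff]
        rw [div_eq_one_iff_eq this.ne']
        push_cast
        linarith
    refine (hs.comp hu).congr fun i => ?_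
    have hi : (0 : ℝ) < ((i + 1 : ℕ) : ℝ) := by positivity
    simp only [Function.comp, slope_def_field, g]
    rw [Real.one_rpow, Real.div_rpow (by positivity) hi.le, Real.rpow_add_one hi.ne']
    have h1 : (i : ℝ) / ((i + 1 : ℕ) : ℝ) - 1 = -1 / ((i + 1 : ℕ) : ℝ) := by
      field_simp; push_cast; ring
    have : ((i + 1 : ℕ) : ℝ) ^ p ≠ 0 := (Real.rpow_pos_of_pos hi p).ne'
    rw [h1]
    field_simp
    ring
  have hlit : (fun i : ℕ => ((i + 1 : ℕ) : ℝ) ^ p - 1 / (p + 1) * g i) =o[atTop] g := by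
    refine (isLittleO_iff_tendsto fun i hi => absurd hi (hgpos i).ne').2 ?_
    have := (hratio.inv₀ hp1.ne').sub_const (1 / (p + 1))
    rw [one_div, sub_self] at this
    refine this.congr fun i => ?_
    have := (hgpos i).ne'
    rw [inv_div, sub_div, mul_div_assoc, div_self this]
    ring
  have hS := hlit.sum_range (fun i => (hgpos i).le) (by
    simp_rw [hsumg]
    exact (tendsto_rpow_atTop hp1).comp tendsto_natCast_atTop_atTop)
  simp_rw [Finset.sum_sub_distrib, ← Finset.mul_sum, hsumg] at hS
  have hS' := hS.tendsto_div_nhds_zero.add_const (1 / (p + 1))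
  rw [zero_add] at hS'
  refine hS'.congr' ?_
  filter_upwards [eventually_gt_atTop 0] with N hN
  have hN0 : (N : ℝ) ^ (p + 1) ≠ 0 := (Real.rpow_pos_of_pos (by exact_mod_cast hN) _).ne'
  have e : ∑ n ∈ Finset.Icc 1 N, (n : ℝ) ^ p = ∑ i ∈ Finset.range N, ((i + 1 : ℕ) : ℝ) ^ p := by
    rw [Finset.range_eq_Ico, Finset.sum_Ico_add' (fun n : ℕ => (n : ℝ) ^ p) 0 N 1]
    rfl
  rw [e, sub_div, mul_div_assoc, div_self hN0]
  ring

/-- Since `a ^ (2σ) = a / a ^ (1 - 2σ)`, replacing `a` by its integer part `N` costs only the factor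
`(N / a) ^ (1 - 2σ) → 1`. -/
lemma tendsto_diagSum {σ : ℝ} (hσ : σ < 1 / 2) :
    Tendsto (fun t => (diagSum σ t * (t / (2 * Real.pi)) ^ σ -
      1 / (1 - 2 * σ) * √(t / (2 * Real.pi))) / √t) atTop (𝓝 0) := by
  have ha : Tendsto (fun t : ℝ => √(t / (2 * Real.pi))) atTop atTop :=
    Real.tendsto_sqrt_atTop.comp (tendsto_id.atTop_div_const (by positivity))
  have hN : Tendsto cutoff atTop atTop := tendsto_nat_floor_atTop.comp ha
  have h1 := (tendsto_sum_rpow_div (p := -(2 * σ)) (by linarith)).comp hN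
  have h2 : Tendsto (fun t : ℝ => (cutoff t : ℝ) / √(t / (2 * Real.pi))) atTop (𝓝 1) :=
    (tendsto_nat_floor_div_atTop (R := ℝ)).comp ha
  have h3 := h2.rpow_const (p := -(2 * σ) + 1) (Or.inl one_ne_zero)
  rw [Real.one_rpow] at h3
  have h4 := ((h1.mul h3).sub_const (1 / (1 - 2 * σ))).mul_const (1 / √(2 * Real.pi))
  have e : (1 / (-(2 * σ) + 1) * 1 - 1 / (1 - 2 * σ)) * (1 / √(2 * Real.pi)) = 0 := by
    rw [mul_one, neg_add_eq_sub, sub_self, zero_mul]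
  rw [e] at h4
  refine h4.congr' ?_
  filter_upwards [ha.eventually_gt_atTop 0, hN.eventually_gt_atTop 0, eventually_gt_atTop 0]
    with t hat hNt ht
  have hN0 : (0 : ℝ) < cutoff t := by exact_mod_cast hNt
  have h5 : √t = √(t / (2 * Real.pi)) * √(2 * Real.pi) := by
    rw [← Real.sqrt_mul (by positivity)]
    congr 1
    field_simp
  have h6 : (0 : ℝ) < √(2 * Real.pi) := by positivity
  rw [div_two_pi_rpow ht.le, h5]
  set a := √(t / (2 * Real.pi))
  simp only [Function.comp]
  rw [← diagSum, Real.div_rpow hN0.le hat.le]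
  have h7 : (0 : ℝ) < (cutoff t : ℝ) ^ (-(2 * σ) + 1) := by positivity
  have h8 : a ^ (2 * σ) = a / a ^ (-(2 * σ) + 1) := by
    rw [Real.rpow_add_one hat.ne', Real.rpow_neg hat.le]
    have : 0 < a ^ (2 * σ) := by positivity
    field_simp
  have h9 : 0 < a ^ (-(2 * σ) + 1) := by positivity
  rw [h8]
  field_simp

/-! ### Measurability and polynomial growth of the terms -/

lemma tame_weight (σ : ℝ) : Tame fun t => (t / (2 * Real.pi)) ^ σ := by
  refine ⟨by fun_prop, 1 + (1 / (2 * Real.pi)) ^ σ, ⌈|σ|⌉₊, by positivity, fun t ht => ?_⟩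
  have ht0 : 0 < t := by linarith
  have hpi : (1 : ℝ) ≤ 2 * Real.pi := by linarith [Real.pi_gt_three]
  have hc : (0 : ℝ) < (1 / (2 * Real.pi)) ^ σ := by positivity
  have htk : 1 ≤ t ^ ⌈|σ|⌉₊ := one_le_pow₀ ht
  rw [abs_of_nonneg (by positivity)]
  rcases le_total 0 σ with h | h
  · have h1 : (t / (2 * Real.pi)) ^ σ ≤ t ^ σ :=
      Real.rpow_le_rpow (by positivity) (div_le_self ht0.le hpi) h
    have h2 : t ^ σ ≤ t ^ ((⌈|σ|⌉₊ : ℕ) : ℝ) :=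
      Real.rpow_le_rpow_of_exponent_le ht ((le_abs_self σ).trans (Nat.le_ceil _))
    rw [Real.rpow_natCast] at h2
    nlinarith
  · have h1 : (t / (2 * Real.pi)) ^ σ ≤ (1 / (2 * Real.pi)) ^ σ :=
      Real.rpow_le_rpow_of_nonpos (by positivity) (by gcongr) h
    nlinarith

lemma tame_sqrt : Tame fun t => √(t / (2 * Real.pi)) := by
  refine ⟨by fun_prop, 1, 1, zero_le_one, fun t ht => ?_⟩
  rw [abs_of_nonneg (Real.sqrt_nonneg _)]
  refine (sqrt_div_two_pi_le (by linarith)).trans ?_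
  rw [Real.sqrt_le_iff]
  constructor <;> nlinarith

lemma tame_sum_rpow (p : ℝ) : Tame fun t => ∑ n ∈ Finset.Icc 1 (cutoff t), (n : ℝ) ^ p := by
  refine ⟨(measurable_from_nat (f := fun N => ∑ n ∈ Finset.Icc 1 N, (n : ℝ) ^ p)).comp
    measurable_cutoff, 1, ⌈|p|⌉₊ + 1, zero_le_one, fun t ht => ?_⟩
  have hN := cutoff_le_self ht
  rw [abs_of_nonneg (Finset.sum_nonneg fun n _ => by positivity)]
  calc _ ≤ ∑ n ∈ Finset.Icc 1 (cutoff t), t ^ ⌈|p|⌉₊ := by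
        refine Finset.sum_le_sum fun n hn => ?_
        have hn := Finset.mem_Icc.1 hn
        have hn1 : (1 : ℝ) ≤ n := by exact_mod_cast hn.1
        have hnt : (n : ℝ) ≤ t := le_trans (by exact_mod_cast hn.2) hN
        calc (n : ℝ) ^ p ≤ (n : ℝ) ^ ((⌈|p|⌉₊ : ℕ) : ℝ) :=
              Real.rpow_le_rpow_of_exponent_le hn1 ((le_abs_self p).trans (Nat.le_ceil _))
          _ = (n : ℝ) ^ ⌈|p|⌉₊ := Real.rpow_natCast _ _
          _ ≤ _ := by gcongr
    _ = cutoff t * t ^ ⌈|p|⌉₊ := by simp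
    _ ≤ t * t ^ ⌈|p|⌉₊ := by gcongr
    _ = _ := by ring

lemma measurable_mainSum (σ : ℝ) : Measurable (mainSum σ) := by
  have hn : ∀ n : ℕ, Measurable fun t : ℝ => (n : ℂ) ^ (-((σ : ℂ) + t * Complex.I)) := by
    intro n
    have hg : Measurable fun t : ℝ => -((σ : ℂ) + t * Complex.I) := by fun_prop
    exact hg.const_pow (n : ℂ)
  have hN : ∀ N : ℕ, Measurable fun t : ℝ =>
      ∑ n ∈ Finset.Icc 1 N, (n : ℂ) ^ (-((σ : ℂ) + t * Complex.I)) := fun N =>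
    Finset.measurable_fun_sum _ fun n _ => hn n
  -- Separating the number of terms from `t` gives joint measurability, because the first variable
  -- is countable.
  let G : ℕ × ℝ → ℂ := fun p =>
    ∑ n ∈ Finset.Icc 1 p.1, (n : ℂ) ^ (-((σ : ℂ) + p.2 * Complex.I))
  have h : Measurable G := measurable_from_prod_countable_right hN
  have e : mainSum σ = fun t => G (cutoff t, t) := rfl
  rw [e]
  exact h.comp (measurable_cutoff.prodMk measurable_id)

lemma tame_norm_mainSum_sq (σ : ℝ) : Tame fun t => ‖mainSum σ t‖ ^ 2 := by
  refine ((tame_sum_rpow (-σ)).mul (tame_sum_rpow (-σ))).mono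
    ((measurable_mainSum σ).norm.pow_const 2) fun t _ => ?_
  have h : ‖mainSum σ t‖ ≤ ∑ n ∈ Finset.Icc 1 (cutoff t), (n : ℝ) ^ (-σ) := by
    refine (norm_sum_le _ _).trans (Finset.sum_le_sum fun n hn => ?_)
    rw [Complex.norm_natCast_cpow_of_pos (Finset.mem_Icc.1 hn).1]
    simp
  rw [abs_of_nonneg (by positivity), ← pow_two, abs_of_nonneg (by positivity)]
  gcongr

lemma measurable_auxR_line (σ : ℝ) :
    Measurable fun t : ℝ => auxR ((σ : ℂ) + (t : ℂ) * Complex.I) := by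
  have h : Measurable (Function.uncurry fun (t u : ℝ) =>
      auxIntegrand ((σ : ℂ) + (t : ℂ) * Complex.I) (1 / 2 + (1 + Complex.I) * (u : ℂ)) *
        (1 + Complex.I)) := by
    unfold auxIntegrand Function.uncurry
    refine Measurable.mul_const (Measurable.div (Measurable.mul ?_ (by fun_prop)) (by fun_prop)) _
    exact Measurable.pow (by fun_prop) (by fun_prop)
  exact (h.stronglyMeasurable.integral_prod_right).measurable.neg

/-! ### From the main sum to the auxiliary function -/

/-- The cross term is split by the arithmetic–geometric inequality, so no correlation between main
sum and remainder has to be estimated. -/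
lemma abs_norm_sq_sub_le {E : Type*} [SeminormedAddCommGroup E] (x y : E) {η : ℝ} (hη : 0 < η) :
    |‖x‖ ^ 2 - ‖y‖ ^ 2| ≤ η * ‖y‖ ^ 2 + (1 + 1 / η) * ‖x - y‖ ^ 2 := by
  have h1 : |‖x‖ - ‖y‖| ≤ ‖x - y‖ := abs_norm_sub_norm_le x y
  have h2 : ‖x‖ + ‖y‖ ≤ ‖x - y‖ + 2 * ‖y‖ := by
    have := (abs_le.1 h1).2
    linarith
  have h3 : 2 * ‖x - y‖ * ‖y‖ ≤ η * ‖y‖ ^ 2 + 1 / η * ‖x - y‖ ^ 2 := by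
    have : 0 ≤ (η * ‖y‖ - ‖x - y‖) ^ 2 / η := by positivity
    have e : (η * ‖y‖ - ‖x - y‖) ^ 2 / η =
        η * ‖y‖ ^ 2 - 2 * ‖x - y‖ * ‖y‖ + 1 / η * ‖x - y‖ ^ 2 := by
      field_simp; ring
    linarith
  calc |‖x‖ ^ 2 - ‖y‖ ^ 2| = |‖x‖ - ‖y‖| * (‖x‖ + ‖y‖) := by
        rw [sq_sub_sq, mul_comm, abs_mul, abs_of_nonneg (by positivity : 0 ≤ ‖x‖ + ‖y‖)]
    _ ≤ ‖x - y‖ * (‖x - y‖ + 2 * ‖y‖) := by gcongr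
    _ ≤ _ := by nlinarith

/-- The weighted square of `auxR` on the line of abscissa `σ`. -/
noncomputable def auxSq (σ t : ℝ) : ℝ :=
  ‖auxR ((σ : ℂ) + (t : ℂ) * Complex.I)‖ ^ 2 * (t / (2 * Real.pi)) ^ σ

/-- `K` does not depend on `η`: the remainder is bounded after weighting, so `η` can be chosen
later. -/
lemma exists_abs_auxSq_sub_le (σ : ℝ) : ∃ K : ℝ, 0 ≤ K ∧ ∀ η : ℝ, 0 < η → ∀ t : ℝ, 1 ≤ t →
    |auxSq σ t - ‖mainSum σ t‖ ^ 2 * (t / (2 * Real.pi)) ^ σ| ≤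
      η * (‖mainSum σ t‖ ^ 2 * (t / (2 * Real.pi)) ^ σ) + (1 + 1 / η) * K := by
  obtain ⟨K, hK, h⟩ := exists_norm_auxR_sub_mainSum_le σ
  refine ⟨K, hK, fun η hη t ht => ?_⟩
  have hw : 0 ≤ (t / (2 * Real.pi)) ^ σ := by positivity
  have h1 := abs_norm_sq_sub_le (auxR ((σ : ℂ) + (t : ℂ) * Complex.I)) (mainSum σ t) hη
  rw [auxSq, ← sub_mul, abs_mul, abs_of_nonneg hw]
  calc _ ≤ (η * ‖mainSum σ t‖ ^ 2 + (1 + 1 / η) *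
        ‖auxR ((σ : ℂ) + (t : ℂ) * Complex.I) - mainSum σ t‖ ^ 2) * (t / (2 * Real.pi)) ^ σ := by
        gcongr
    _ = η * (‖mainSum σ t‖ ^ 2 * (t / (2 * Real.pi)) ^ σ) + (1 + 1 / η) *
        (‖auxR ((σ : ℂ) + (t : ℂ) * Complex.I) - mainSum σ t‖ ^ 2 * (t / (2 * Real.pi)) ^ σ) := by
        ring
    _ ≤ _ := by
        gcongr
        exact h t ht

lemma tame_auxSq (σ : ℝ) : Tame (auxSq σ) := by
  obtain ⟨K, hK, h⟩ := exists_abs_auxSq_sub_le σ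
  have hS := (tame_norm_mainSum_sq σ).mul (tame_weight σ)
  refine ((hS.add hS).add (Tame.const (2 * K))).mono
    (((measurable_auxR_line σ).norm.pow_const 2).mul (tame_weight σ).meas) fun t ht => ?_
  have h1 := h 1 one_pos t ht
  have h2 : 0 ≤ ‖mainSum σ t‖ ^ 2 * (t / (2 * Real.pi)) ^ σ := by positivity
  have h3 : 0 ≤ auxSq σ t := by unfold auxSq; positivity
  rw [abs_of_nonneg h3, abs_of_nonneg (by positivity)]
  have := (abs_le.1 h1).2
  linarith

theorem meanNegligible_mainSum {σ : ℝ} (hσ : σ < 1 / 2) :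
    MeanNegligible fun t => ‖mainSum σ t‖ ^ 2 * (t / (2 * Real.pi)) ^ σ -
      1 / (1 - 2 * σ) * √(t / (2 * Real.pi)) := by
  have td : Tame fun t => diagSum σ t * (t / (2 * Real.pi)) ^ σ -
      1 / (1 - 2 * σ) * √(t / (2 * Real.pi)) :=
    ((tame_sum_rpow _).mul (tame_weight σ)).sub ((Tame.const _).mul tame_sqrt)
  have tod : Tame fun t => offDiagSum σ t * (t / (2 * Real.pi)) ^ σ := by
    refine Tame.mul ?_ (tame_weight σ)
    have := (tame_norm_mainSum_sq σ).sub (tame_sum_rpow (-(2 * σ)))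
    convert this using 2 with t
    rw [norm_mainSum_sq, diagSum, add_sub_cancel_left]
  have := (MeanNegligible.of_tendsto td (tendsto_diagSum hσ)).add (meanNegligible_offDiagSum hσ) td tod
  convert this using 2 with t
  rw [norm_mainSum_sq]
  ring

theorem meanNegligible_auxSq {σ : ℝ} (hσ : σ < 1 / 2) :
    MeanNegligible fun t => auxSq σ t - 1 / (1 - 2 * σ) * √(t / (2 * Real.pi)) := by
  have hκ : 0 < 1 / (1 - 2 * σ) := one_div_pos.2 (by linarith)
  set κ := 1 / (1 - 2 * σ) with hκd
  set V : ℝ → ℝ := fun t => ‖mainSum σ t‖ ^ 2 * (t / (2 * Real.pi)) ^ σ with hV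
  have tV : Tame V := (tame_norm_mainSum_sq σ).mul (tame_weight σ)
  have ta : Tame fun t => κ * √(t / (2 * Real.pi)) := (Tame.const _).mul tame_sqrt
  have nV : MeanNegligible fun t => V t - κ * √(t / (2 * Real.pi)) := meanNegligible_mainSum hσ
  have nE : MeanNegligible fun t => auxSq σ t - V t := by
    intro η hη
    obtain ⟨K, hK, hE⟩ := exists_abs_auxSq_sub_le σ
    obtain ⟨C, hC, h1⟩ := nV 1 one_pos
    -- The weighted main sum has integral at most `(1 + κ) T ^ (3 / 2) + C T`; this `δ` turns its
    -- leading part into `η T ^ (3 / 2)`.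
    set δ := η / (1 + κ) with hδ
    have hδ0 : 0 < δ := by positivity
    refine ⟨δ * C + (1 + 1 / δ) * K, by positivity, fun T hT => ?_⟩
    have hVint := tV.intervalIntegrable hT
    have haint := ta.intervalIntegrable hT
    have h2 := (abs_le.1 (h1 T hT)).2
    rw [intervalIntegral.integral_sub hVint haint, intervalIntegral.integral_const_mul] at h2
    have h3 : ∫ t in (1 : ℝ)..T, √(t / (2 * Real.pi)) ≤ T ^ (3 / 2 : ℝ) :=
      (intervalIntegral.integral_mono_on hT (tame_sqrt.intervalIntegrable hT)
        (Real.continuous_sqrt.intervalIntegrable _ _)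
        fun t ht => sqrt_div_two_pi_le (by linarith [ht.1])).trans (integral_sqrt_le hT)
    have h4 : |∫ t in (1 : ℝ)..T, (auxSq σ t - V t)| ≤
        ∫ t in (1 : ℝ)..T, (δ * V t + (1 + 1 / δ) * K) := by
      refine (intervalIntegral.abs_integral_le_integral_abs hT).trans ?_
      refine intervalIntegral.integral_mono_on hT
        (((tame_auxSq σ).sub tV).abs.intervalIntegrable hT)
        ((hVint.const_mul δ).add (continuous_const.intervalIntegrable _ _))
        fun t ht => hE δ hδ0 t ht.1
    rw [intervalIntegral.integral_add (hVint.const_mul δ) (continuous_const.intervalIntegrable _ _),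
      intervalIntegral.integral_const_mul, intervalIntegral.integral_const, smul_eq_mul] at h4
    have h5 : ∫ t in (1 : ℝ)..T, V t ≤ (1 + κ) * T ^ (3 / 2 : ℝ) + C * T := by
      have := mul_le_mul_of_nonneg_left h3 hκ.le
      linarith
    have h6 : δ * (1 + κ) = η := by rw [hδ]; field_simp
    have h7 := mul_le_mul_of_nonneg_left h5 hδ0.le
    have h8 : 0 ≤ (1 + 1 / δ) * K := by positivity
    calc _ ≤ _ := h4
      _ ≤ δ * ((1 + κ) * T ^ (3 / 2 : ℝ) + C * T) + T * ((1 + 1 / δ) * K) := by nlinarith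
      _ = (δ * (1 + κ)) * T ^ (3 / 2 : ℝ) + (δ * C + (1 + 1 / δ) * K) * T := by ring
      _ = _ := by rw [h6]
  have := nV.add nE (tV.sub ta) ((tame_auxSq σ).sub tV)
  convert this using 2 with t
  ring

/-! ### The Laplace transform of the main term and the conclusion -/

lemma setIntegral_Ioi_sqrt_mul_exp {ε : ℝ} (hε : 0 < ε) :
    IntegrableOn (fun t : ℝ => √(t / (2 * Real.pi)) * Real.exp (-(ε * t))) (Ioi 0) ∧
    ∫ t in Ioi (0 : ℝ), √(t / (2 * Real.pi)) * Real.exp (-(ε * t)) = (2 * ε) ^ (-(3 / 2) : ℝ) := by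
  obtain ⟨h1, h2⟩ := setIntegral_Ioi_rpow_mul_exp (a := 3 / 2) (by norm_num) hε
  have e : ∀ t ∈ Ioi (0 : ℝ), 1 / √(2 * Real.pi) * (t ^ ((3 / 2 : ℝ) - 1) * Real.exp (-(ε * t))) =
      √(t / (2 * Real.pi)) * Real.exp (-(ε * t)) := by
    intro t ht
    have ht : 0 < t := ht
    rw [Real.sqrt_div ht.le, Real.sqrt_eq_rpow t]
    norm_num
    ring
  refine ⟨IntegrableOn.congr_fun (h1.const_mul _) e measurableSet_Ioi, ?_⟩
  rw [← setIntegral_congr_fun measurableSet_Ioi e, integral_const_mul, h2]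
  have hG : Real.Gamma (3 / 2) = 1 / 2 * √Real.pi := by
    rw [show (3 / 2 : ℝ) = 1 / 2 + 1 by norm_num, Real.Gamma_add_one (by norm_num),
      Real.Gamma_one_half_eq]
  have h3 : (2 : ℝ) ^ (-(3 / 2) : ℝ) = 1 / (2 * √2) := by
    rw [Real.rpow_neg (by norm_num), ← mul_sqrt_eq_rpow (by norm_num)]
    simp
  rw [hG, Real.mul_rpow (by norm_num) hε.le, h3, Real.sqrt_mul (by norm_num)]
  have : √Real.pi ≠ 0 := (Real.sqrt_pos.2 Real.pi_pos).ne'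
  field_simp

/-- The difference is the integral over `(0, 1]`, where the integrand is at most `1`. -/
lemma abs_setIntegral_Ioi_one_sqrt_sub_le {ε : ℝ} (hε : 0 < ε) :
    |(∫ t in Ioi (1 : ℝ), √(t / (2 * Real.pi)) * Real.exp (-(ε * t))) -
      (2 * ε) ^ (-(3 / 2) : ℝ)| ≤ 1 := by
  obtain ⟨h1, h2⟩ := setIntegral_Ioi_sqrt_mul_exp hε
  have hs : Ioi (0 : ℝ) = Ioc 0 1 ∪ Ioi 1 := (Ioc_union_Ioi_eq_Ioi zero_le_one).symm
  have h3 : IntegrableOn (fun t : ℝ => √(t / (2 * Real.pi)) * Real.exp (-(ε * t))) (Ioc 0 1) :=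
    h1.mono_set Ioc_subset_Ioi_self
  rw [hs, setIntegral_union (by
    rw [Set.disjoint_left]
    rintro x ⟨_, hx⟩ hx'
    exact absurd hx' (not_lt.2 hx)) measurableSet_Ioi h3
    (h1.mono_set (Ioi_subset_Ioi zero_le_one))] at h2
  rw [← h2, sub_add_cancel_right, abs_neg, ← Real.norm_eq_abs]
  refine (norm_setIntegral_le_of_norm_le_const (C := 1) (by simp) fun t ht => ?_).trans (by simp)
  have ht0 : 0 < t := ht.1
  rw [norm_mul, Real.norm_eq_abs, Real.norm_eq_abs, Real.abs_exp, abs_of_nonneg (Real.sqrt_nonneg _)]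
  refine mul_le_one₀ ?_ (Real.exp_pos _).le (Real.exp_le_one_iff.2 (by nlinarith))
  refine (sqrt_div_two_pi_le ht0.le).trans ?_
  exact Real.sqrt_le_one.2 ht.2

theorem theorem3 (σ : ℝ) (hσ : σ < 1 / 2) :
    (∀ ε : ℝ, 0 < ε → IntegrableOn (fun t : ℝ =>
        ‖auxR ((σ : ℂ) + (t : ℂ) * Complex.I)‖ ^ 2 * (t / (2 * Real.pi)) ^ σ *
          Real.exp (-(ε * t))) (Ioi (1 : ℝ)) volume) ∧
    (fun ε : ℝ =>
        (∫ t in Ioi (1 : ℝ),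
          ‖auxR ((σ : ℂ) + (t : ℂ) * Complex.I)‖ ^ 2 * (t / (2 * Real.pi)) ^ σ *
            Real.exp (-(ε * t)))
        - (2 * ε) ^ (-(3 / 2) : ℝ) / (1 - 2 * σ))
      =o[𝓝[>] (0 : ℝ)] (fun ε : ℝ => ε ^ (-(3 / 2) : ℝ)) := by
  refine ⟨fun ε hε => (tame_auxSq σ).integrableOn_mul_exp hε, ?_⟩
  have hκ : 0 < 1 / (1 - 2 * σ) := one_div_pos.2 (by linarith)
  have ta : Tame fun t => 1 / (1 - 2 * σ) * √(t / (2 * Real.pi)) := (Tame.const _).mul tame_sqrt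
  rw [isLittleO_iff]
  intro η hη
  obtain ⟨C, hC, hL⟩ := (meanNegligible_auxSq hσ).abs_laplace_le ((tame_auxSq σ).sub ta)
    (half_pos hη)
  set κ := 1 / (1 - 2 * σ) with hκd
  -- These are the errors `C ε ^ (-1)` and `κ`, the latter from integrating only over `t > 1`, after
  -- division by `ε ^ (-3 / 2)`.
  have hsmall : Tendsto (fun ε : ℝ => C * ε ^ (1 / 2 : ℝ) + κ * ε ^ (3 / 2 : ℝ)) (𝓝[>] 0) (𝓝 0) := by
    have h : ContinuousAt (fun ε : ℝ => C * ε ^ (1 / 2 : ℝ) + κ * ε ^ (3 / 2 : ℝ)) 0 := by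
      refine ContinuousAt.add ?_ ?_ <;>
      exact continuousAt_const.mul (Real.continuousAt_rpow_const _ _ (Or.inr (by norm_num)))
    have h2 := h.tendsto.mono_left (nhdsWithin_le_nhds (s := Ioi 0))
    have e : C * (0 : ℝ) ^ (1 / 2 : ℝ) + κ * (0 : ℝ) ^ (3 / 2 : ℝ) = 0 := by
      rw [Real.zero_rpow (by norm_num), Real.zero_rpow (by norm_num)]; ring
    rwa [e] at h2
  filter_upwards [(tendsto_order.1 hsmall).2 (η / 2) (by positivity), self_mem_nhdsWithin]
    with ε hε1 hε
  have hε : 0 < ε := hε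
  have h1 := hL ε hε
  have h2 := abs_setIntegral_Ioi_one_sqrt_sub_le hε
  have i1 := (tame_auxSq σ).integrableOn_mul_exp hε
  have i2 := tame_sqrt.integrableOn_mul_exp hε
  have hsplit : ∫ t in Ioi (1 : ℝ), (auxSq σ t - κ * √(t / (2 * Real.pi))) * Real.exp (-(ε * t)) =
      (∫ t in Ioi (1 : ℝ), auxSq σ t * Real.exp (-(ε * t))) -
        κ * ∫ t in Ioi (1 : ℝ), √(t / (2 * Real.pi)) * Real.exp (-(ε * t)) := by
    rw [← integral_const_mul, ← integral_sub i1 (i2.const_mul κ)]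
    congr 1
    funext t
    ring
  rw [hsplit] at h1
  have hgoal : (∫ t in Ioi (1 : ℝ), auxSq σ t * Real.exp (-(ε * t))) -
      (2 * ε) ^ (-(3 / 2) : ℝ) / (1 - 2 * σ) =
      ((∫ t in Ioi (1 : ℝ), auxSq σ t * Real.exp (-(ε * t))) -
        κ * ∫ t in Ioi (1 : ℝ), √(t / (2 * Real.pi)) * Real.exp (-(ε * t))) +
      κ * ((∫ t in Ioi (1 : ℝ), √(t / (2 * Real.pi)) * Real.exp (-(ε * t))) -
        (2 * ε) ^ (-(3 / 2) : ℝ)) := by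
    rw [hκd]; ring
  have hpos : 0 < ε ^ (-(3 / 2) : ℝ) := by positivity
  have e1 : ε ^ (-1 : ℝ) = ε ^ (1 / 2 : ℝ) * ε ^ (-(3 / 2) : ℝ) := by
    rw [← Real.rpow_add hε]; norm_num
  have e2 : 1 = ε ^ (3 / 2 : ℝ) * ε ^ (-(3 / 2) : ℝ) := by
    rw [← Real.rpow_add hε]; norm_num
  change ‖(∫ t in Ioi (1 : ℝ), auxSq σ t * Real.exp (-(ε * t))) -
      (2 * ε) ^ (-(3 / 2) : ℝ) / (1 - 2 * σ)‖ ≤ _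
  rw [hgoal, Real.norm_eq_abs, Real.norm_eq_abs, abs_of_pos hpos]
  refine (abs_add_le _ _).trans ?_
  rw [abs_mul, abs_of_pos hκ]
  have h3 := mul_le_mul_of_nonneg_left h2 hκ.le
  calc _ ≤ η / 2 * ε ^ (-(3 / 2) : ℝ) + C * ε ^ (-1 : ℝ) + κ * 1 := add_le_add h1 h3
    _ = η / 2 * ε ^ (-(3 / 2) : ℝ) +
        (C * ε ^ (1 / 2 : ℝ) + κ * ε ^ (3 / 2 : ℝ)) * ε ^ (-(3 / 2) : ℝ) := by
        rw [e1, add_mul, mul_assoc κ, ← e2]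
        ring
    _ ≤ η / 2 * ε ^ (-(3 / 2) : ℝ) + η / 2 * ε ^ (-(3 / 2) : ℝ) := by gcongr
    _ = _ := by ring
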